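/- Let $\alpha>0$, let $N$ be a natural number, and let $\Gamma=\Gamma_1\cup\dots\cup\Gamma_N\subset\mathbb R^2$, where each $\Gamma_i$ is a Borel set (for instance an arc) contained in a curve $\Gamma_i^{ext}$. Each $\Gamma_i^{ext}$ is the image of a continuous, piecewise-$C^1$ map $\gamma_i$ with $|\dot\gamma_i|=1$ (finitely many break points in every bounded interval; $C^1$ up to the end points between break points) which is of one of two kinds: (a) a loop: $\gamma_i:[0,L_i]\to\mathbb R^2$ with $L_i>0$ and $\gamma_i(0)=\gamma_i(L_i)$; the distance along the curve is $d_i(s,s')=\min\{|s-s'|,L_i-|s-s'|\}$; (b) an asymptotically straight infinite curve: $\gamma_i:\mathbb R\to\mathbb R^2$, with $d_i(s,s')=|s-s'|$, such that for some $d>0$, $\mu>\frac12$, $\omega\in(0,1)$ $$1-\frac{|\gamma_i(s)-\gamma_i(s')|}{|s-s'|}\le d\,\bigl[1+|s+s'|^{2\mu}\bigr]^{-1/2}\quad\text{whenever } s\ne s',\ s'\neq 0,\ \omega\le \tfrac{s}{s'}\le\omega^{-1}.$$ Put $$c(\Gamma_i^{ext})=\inf_{d_i(s,s')>0}\frac{|\gamma_i(s)-\gamma_i(s')|}{d_i(s,s')}$$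 and suppose that $c(\Gamma_i^{ext})>0$ for every $i$. Let $m_\Gamma(M)=\mathcal H^1(M\cap\Gamma)$, where $\mathcal H^1$ is the one-dimensional Hausdorff measure. Then: 1. There is exactly one linear map $I_\Gamma:H^1(\mathbb R^2)\to L^2(\mathbb R^2,m_\Gamma)$ that is bounded for the $H^1$ norm and satisfies $I_\Gamma\varphi=\varphi$ $m_\Gamma$-almost everywhere for every Schwartz function $\varphi$. 2. The quadratic form $$q_{\alpha,\Gamma}[u]=\int_{\mathbb R^2}|\nabla u|^2\,dx-\alpha\int|I_\Gamma u|^2\,dm_\Gamma,\qquad \operatorname{dom}q_{\alpha,\Gamma}=H^1(\mathbb R^2),$$ in $L^2(\mathbb R^2)$ (complex-valued functions) is closed and bounded below. 3. There is exactly one self-adjoint operator $H_{\alpha,\Gamma}$ in $L^2(\mathbb R^2)$ defined by this form (that is, $u\in\operatorname{dom}H_{\alpha,\Gamma}$ and $H_{\alpha,\Gamma}u=f$ if and only if $u\in H^1(\mathbb R^2)$ and $q_{\alpha,\Gamma}(v,u)=\langle v,f\rangle$ for all $v\in H^1(\mathbb R^2)$, where $q_{\alpha,\Gamma}(\cdot,\cdot)$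 is the associated sesquilinear form). Its spectrum is non-empty, bounded below, and $$\inf\sigma(H_{\alpha,\Gamma})\ \ge\ -N\sum_{i=1}^N\frac{\alpha^2}{4\,c(\Gamma_i^{ext})^2}.$$ -/

import Mathlib

open Set Filter Topology MeasureTheory
open scoped ENNReal SchwartzMap LineDeriv

noncomputable section

namespace LeakyWire

/-- The Euclidean plane `ℝ²`. -/
abbrev Plane : Type := EuclideanSpace ℝ (Fin 2)

/-! ### Curves -/

/-- `γ`, restricted to the interval `I`, is continuous, piecewise `C¹` and parametrised by arc
length: away from a set `B` of break points, finitely many in each bounded interval, the speed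
is `1`, and `γ` is `C¹` up to the end points on every compact interval whose interior contains
no break point. -/
def IsNaturalParamOn (γ : ℝ → Plane) (I : Set ℝ) : Prop :=
  ContinuousOn γ I ∧
  ∃ B : Set ℝ, (∀ a b : ℝ, (B ∩ Icc a b).Finite) ∧
    ∀ a b : ℝ, a < b → Icc a b ⊆ I → Disjoint (Ioo a b) B →
      ContDiffOn ℝ 1 γ (Icc a b) ∧ ∀ s ∈ Ioo a b, ‖deriv γ s‖ = 1

/-- A bounded closed curve (loop) of length `L > 0`: only the values of `γ` on `[0, L]` are
used. -/
structure Loop where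
  L : ℝ
  L_pos : 0 < L
  γ : ℝ → Plane
  natural : IsNaturalParamOn γ (Icc 0 L)
  closed : γ L = γ 0

/-- An infinite curve, parametrised by arc length over the whole real line. -/
structure InfiniteCurve where
  γ : ℝ → Plane
  natural : IsNaturalParamOn γ univ

/-- Distance along the loop between the points with parameters `s, s' ∈ [0, L]`. -/
def Loop.curveDist (C : Loop) (s s' : ℝ) : ℝ := min |s - s'| (C.L - |s - s'|)

/-- `c(Γ)` for a loop: the infimum of (distance in the plane) / (distance along the curve) over
pairs of points at positive distance along the curve. -/
def Loop.c (C : Loop) : ℝ :=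
  sInf {r : ℝ | ∃ s ∈ Icc 0 C.L, ∃ s' ∈ Icc 0 C.L,
    0 < C.curveDist s s' ∧ r = dist (C.γ s) (C.γ s') / C.curveDist s s'}

/-- `c(Γ)` for an infinite curve: the infimum of (distance in the plane) / (distance along the
curve). -/
def InfiniteCurve.c (C : InfiniteCurve) : ℝ :=
  sInf {r : ℝ | ∃ s s' : ℝ, s ≠ s' ∧ r = dist (C.γ s) (C.γ s') / |s - s'|}

/-- Asymptotic straightness of an infinite curve: for some `d > 0`, `μ > 1/2`, `ω ∈ (0, 1)`, a
decay estimate holds in the sector `ω ≤ s / s' ≤ ω⁻¹` (off the diagonal `s = s'`, where the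
quotient is not defined). -/
def InfiniteCurve.AsymptoticallyStraight (C : InfiniteCurve) : Prop :=
  ∃ d μ ω : ℝ, 0 < d ∧ 1 / 2 < μ ∧ 0 < ω ∧ ω < 1 ∧
    ∀ s s' : ℝ, s' ≠ 0 → s ≠ s' → ω ≤ s / s' → s / s' ≤ ω⁻¹ →
      1 - dist (C.γ s) (C.γ s') / |s - s'|
        ≤ d * (1 + |s + s'| ^ (2 * μ)) ^ (-(1 / 2) : ℝ)

/-- A curve that is either a loop or an infinite curve. -/
inductive PlaneCurve where
  | loop (C : Loop) : PlaneCurve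
  | infinite (C : InfiniteCurve) : PlaneCurve

/-- The set of points of the curve. -/
def PlaneCurve.carrier : PlaneCurve → Set Plane
  | .loop C => C.γ '' Icc 0 C.L
  | .infinite C => range C.γ

/-- The constant `c(Γ)`. -/
def PlaneCurve.c : PlaneCurve → ℝ
  | .loop C => C.c
  | .infinite C => C.c

/-- The curve is a loop or an asymptotically straight infinite curve. -/
def PlaneCurve.LoopOrStraight : PlaneCurve → Prop
  | .loop _ => True
  | .infinite C => C.AsymptoticallyStraight

/-- The measure `m_Γ(M) = l₁(M ∩ Γ)`, with `l₁` the one-dimensional Hausdorff measure. -/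
def curveMeasure (Γ : Set Plane) : Measure Plane :=
  (Measure.hausdorffMeasure 1 : Measure Plane).restrict Γ

/-! ### The Sobolev space `H¹(ℝ²)` -/

/-- `L²(ℝ²)`, complex-valued. -/
abbrev L2 : Type := Lp ℂ 2 (volume : Measure Plane)

/-- The distributional partial derivative `∂_j u` is the `L²` function `g`. -/
def HasWeakPartial (j : Fin 2) (u g : L2) : Prop :=
  ∂_{(EuclideanSpace.single j (1 : ℝ) : Plane)} (u : 𝓢'(Plane, ℂ)) = (g : 𝓢'(Plane, ℂ))

theorem toDist_add (u v : L2) :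
    ((u + v : L2) : 𝓢'(Plane, ℂ)) = (u : 𝓢'(Plane, ℂ)) + (v : 𝓢'(Plane, ℂ)) :=
  map_add (Lp.toTemperedDistributionCLM ℂ (volume : Measure Plane) 2) u v

theorem toDist_smul (a : ℂ) (u : L2) :
    ((a • u : L2) : 𝓢'(Plane, ℂ)) = a • (u : 𝓢'(Plane, ℂ)) :=
  map_smul (Lp.toTemperedDistributionCLM ℂ (volume : Measure Plane) 2) a u

theorem toDist_injective (u v : L2) (h : (u : 𝓢'(Plane, ℂ)) = (v : 𝓢'(Plane, ℂ))) : u = v :=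
  LinearMap.ker_eq_bot.mp
    (Lp.ker_toTemperedDistributionCLM_eq_bot (F := ℂ) (μ := (volume : Measure Plane)) (p := 2)) h

theorem HasWeakPartial.add {j : Fin 2} {u v g h : L2} (hu : HasWeakPartial j u g)
    (hv : HasWeakPartial j v h) : HasWeakPartial j (u + v) (g + h) := by
  unfold HasWeakPartial at *
  rw [toDist_add, toDist_add, LineDeriv.lineDerivOp_add, hu, hv]

theorem HasWeakPartial.smul {j : Fin 2} {u g : L2} (a : ℂ) (hu : HasWeakPartial j u g) :
    HasWeakPartial j (a • u) (a • g) := by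
  unfold HasWeakPartial at *
  rw [toDist_smul, toDist_smul, LineDeriv.lineDerivOp_smul, hu]

theorem HasWeakPartial.unique {j : Fin 2} {u g h : L2} (hg : HasWeakPartial j u g)
    (hh : HasWeakPartial j u h) : g = h :=
  toDist_injective g h (hg.symm.trans hh)

/-- `H¹(ℝ²)`: the `L²` functions whose distributional first partial derivatives are in `L²`. -/
def H1 : Submodule ℂ L2 where
  carrier := {u | ∀ j, ∃ g, HasWeakPartial j u g}
  add_mem' {u v} hu hv := fun j => by
    obtain ⟨g, hg⟩ := hu j
    obtain ⟨h, hh⟩ := hv j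
    exact ⟨g + h, hg.add hh⟩
  zero_mem' := fun j => ⟨0, by simpa using (show HasWeakPartial j (0 : L2) 0 from by
    have h0 : ((0 : L2) : 𝓢'(Plane, ℂ)) = 0 :=
      map_zero (Lp.toTemperedDistributionCLM ℂ (volume : Measure Plane) 2)
    unfold HasWeakPartial
    rw [h0, LineDeriv.lineDerivOp_zero])⟩
  smul_mem' a u hu := fun j => by
    obtain ⟨g, hg⟩ := hu j
    exact ⟨a • g, hg.smul a⟩

/-- The weak partial derivative `∂_j : H¹(ℝ²) → L²(ℝ²)`. -/
def weakPartial (j : Fin 2) : H1 →ₗ[ℂ] L2 where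
  toFun u := (u.2 j).choose
  map_add' u v := ((u + v).2 j).choose_spec.unique ((u.2 j).choose_spec.add (v.2 j).choose_spec)
  map_smul' a u := ((a • u).2 j).choose_spec.unique ((u.2 j).choose_spec.smul a)

theorem hasWeakPartial_weakPartial (j : Fin 2) (u : H1) :
    HasWeakPartial j (u : L2) (weakPartial j u) := (u.2 j).choose_spec

/-- A Schwartz function as an element of `L²(ℝ²)`. -/
def schwartzToL2 (φ : 𝓢(Plane, ℂ)) : L2 := SchwartzMap.toLp φ 2 (volume : Measure Plane)

theorem toDist_schwartz (φ : 𝓢(Plane, ℂ)) :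
    (schwartzToL2 φ : 𝓢'(Plane, ℂ)) = (φ : 𝓢'(Plane, ℂ)) :=
  Lp.toTemperedDistribution_toLp_eq φ

theorem lineDeriv_schwartz (e : Plane) (φ : 𝓢(Plane, ℂ)) :
    ∂_{e} (φ : 𝓢'(Plane, ℂ)) = ((∂_{e} φ : 𝓢(Plane, ℂ)) : 𝓢'(Plane, ℂ)) :=
  TemperedDistribution.lineDerivOp_toTemperedDistributionCLM_eq φ e

theorem hasWeakPartial_schwartz (j : Fin 2) (φ : 𝓢(Plane, ℂ)) :
    HasWeakPartial j (schwartzToL2 φ)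
      (schwartzToL2 (∂_{(EuclideanSpace.single j (1 : ℝ) : Plane)} φ)) := by
  unfold HasWeakPartial
  rw [toDist_schwartz, toDist_schwartz, lineDeriv_schwartz]

/-- A Schwartz function as an element of `H¹(ℝ²)`. -/
def schwartzToH1 (φ : 𝓢(Plane, ℂ)) : H1 :=
  ⟨schwartzToL2 φ, fun j => ⟨_, hasWeakPartial_schwartz j φ⟩⟩

/-- The square of the `H¹` norm. -/
def h1NormSq (u : H1) : ℝ := ‖(u : L2)‖ ^ 2 + ∑ j, ‖weakPartial j u‖ ^ 2

/-- `I` is a trace map `H¹(ℝ²) → L²(m)`: it is linear, bounded for the `H¹` norm, and maps every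
Schwartz function to itself as an element of `L²(m)`. -/
def IsTrace (m : Measure Plane) (I : H1 →ₗ[ℂ] Lp ℂ 2 m) : Prop :=
  (∃ K : ℝ, ∀ u, ‖I u‖ ^ 2 ≤ K * h1NormSq u) ∧
  ∀ φ : 𝓢(Plane, ℂ), ((I (schwartzToH1 φ) : Lp ℂ 2 m) : Plane → ℂ) =ᵐ[m] φ

/-! ### Quadratic forms and operators in a Hilbert space -/

section Hilbert

variable {H : Type*} [NormedAddCommGroup H] [InnerProductSpace ℂ H]

variable (H) in
/-- A symmetric sesquilinear form in `H`, defined on a linear subspace. -/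
structure SymmForm where
  domain : Submodule ℂ H
  form : domain →ₗ⋆[ℂ] domain →ₗ[ℂ] ℂ
  symm : ∀ u v, (starRingEnd ℂ) (form u v) = form v u

/-- The quadratic form `q[u]`, which is real by symmetry. -/
def SymmForm.quad (q : SymmForm H) (u : q.domain) : ℝ := (q.form u u).re

/-- Semiboundedness from below. -/
def SymmForm.IsBoundedBelow (q : SymmForm H) : Prop :=
  ∃ b : ℝ, ∀ u : q.domain, b * ‖(u : H)‖ ^ 2 ≤ q.quad u

/-- Closedness: if `uₙ ∈ dom q`, `uₙ → x` in `H` and `q[uₙ - uₘ] → 0`, then `x ∈ dom q` and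
`q[uₙ - x] → 0`. -/
def SymmForm.IsClosed (q : SymmForm H) : Prop :=
  ∀ (u : ℕ → q.domain) (x : H), Tendsto (fun n => (u n : H)) atTop (𝓝 x) →
    Tendsto (fun p : ℕ × ℕ => q.quad (u p.1 - u p.2)) atTop (𝓝 0) →
    ∃ v : q.domain, (v : H) = x ∧ Tendsto (fun n => q.quad (u n - v)) atTop (𝓝 0)

/-- `A` is the operator defined via the form `q`: `u ∈ dom A` and `A u = f` if and only if
`u ∈ dom q` and `q(v, u) = ⟨v, f⟩` for all `v ∈ dom q`. -/
def SymmForm.IsAssociated (q : SymmForm H) (A : H →ₗ.[ℂ] H) : Prop :=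
  ∀ u f : H, (u, f) ∈ A.graph ↔
    ∃ hu : u ∈ q.domain, ∀ v : q.domain, q.form v ⟨u, hu⟩ = inner ℂ (v : H) f

/-- `z` is in the resolvent set of the unbounded operator `A`: `A - z` is a bijection of `dom A`
onto `H` with a bounded inverse. -/
def resolventSet (A : H →ₗ.[ℂ] H) : Set ℂ :=
  {z | ∃ R : H →L[ℂ] H,
    (∀ y : H, ∃ hy : R y ∈ A.domain, A ⟨R y, hy⟩ - z • R y = y) ∧
    ∀ x : A.domain, R (A x - z • (x : H)) = x}

/-- The spectrum of the unbounded operator `A`. -/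
def spectrum (A : H →ₗ.[ℂ] H) : Set ℂ := (resolventSet A)ᶜ

/-- The spectrum as a set of real numbers; for self-adjoint `A` the spectrum is real, so that
nothing is lost by taking real parts. -/
def realSpectrum (A : H →ₗ.[ℂ] H) : Set ℝ := Complex.re '' spectrum A

end Hilbert

/-- The form `q_{α,Γ}` with domain `H¹(ℝ²)`, polarised:
`q(u, v) = ∫ ⟨∇u, ∇v⟩ dx - α ∫ ⟨I u, I v⟩ dm`. -/
def deltaForm (α : ℝ) (m : Measure Plane) (I : H1 →ₗ[ℂ] Lp ℂ 2 m) : SymmForm L2 where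
  domain := H1
  form := LinearMap.mk₂'ₛₗ (starRingEnd ℂ) (RingHom.id ℂ)
    (fun u v => ∑ j, inner ℂ (weakPartial j u) (weakPartial j v) - (α : ℂ) * inner ℂ (I u) (I v))
    (fun u u' v => by
      simp only [map_add, inner_add_left, Finset.sum_add_distrib]; ring)
    (fun a u v => by
      simp only [map_smul, inner_smul_left, ← Finset.mul_sum, smul_eq_mul]; ring)
    (fun u v v' => by
      simp only [map_add, inner_add_right, Finset.sum_add_distrib]; ring)
    (fun a u v => by
      simp only [map_smul, inner_smul_right, ← Finset.mul_sum, smul_eq_mul, RingHom.id_apply]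
      ring)
  symm u v := by
    simp [LinearMap.mk₂'ₛₗ_apply, map_sub, map_mul]

theorem deltaForm_quad (α : ℝ) (m : Measure Plane) (I : H1 →ₗ[ℂ] Lp ℂ 2 m) (u : H1) :
    (deltaForm α m I).quad u = ∑ j, ‖weakPartial j u‖ ^ 2 - α * ‖I u‖ ^ 2 := by
  have h : (deltaForm α m I).quad u = (∑ j, inner ℂ (weakPartial j u) (weakPartial j u)
    - (α : ℂ) * inner ℂ (I u) (I u)).re := rfl
  rw [h]
  have h1 : ∀ x : L2, inner ℂ x x = ((‖x‖ ^ 2 : ℝ) : ℂ) := fun x => by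
    rw [inner_self_eq_norm_sq_to_K]; norm_cast
  have h2 : inner ℂ (I u) (I u) = ((‖I u‖ ^ 2 : ℝ) : ℂ) := by
    rw [inner_self_eq_norm_sq_to_K]; norm_cast
  simp only [h1, h2]
  rw [← Complex.ofReal_sum, ← Complex.ofReal_mul, ← Complex.ofReal_sub, Complex.ofReal_re]

end LeakyWire

end

/-! Everything follows from one trace inequality: for every `β > 0`, `∫ |φ|² dm ≤ β⁻¹ ‖∇φ‖² + β S
‖φ‖²` with `S = N ∑ 1 / (4 cᵢ²)`. Multiplied by `α`, the choice `β = α` gives `q ≥ -α² S`, and `β =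
2α` leaves half of the Dirichlet energy, so that the form norm is equivalent to the `H¹` norm and
the form is closed. Density of Schwartz functions in `H¹` extends the restriction map uniquely. The
first representation theorem supplies the operator, and every point below the form bound lies in its
resolvent set.

For one piece the inequality is `∫ |φ|² dm ≤ (2κc)⁻¹ (‖∇φ‖² + κ² ‖φ‖²)` for all `κ > 0`. By duality
it amounts to a Birman–Schwinger bound: the operator on `L²(m)` whose kernel is that of `(-Δ +
κ²)⁻¹` has norm at most `1 / (2κc)`, the value for a straight line divided by `c`. Writing the
resolvent as a Laplace transform of the heat semigroup reduces the bound to Gaussian kernels, and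
the Schur test reduces those to `∫ exp (-a |x - y|²) dm(y) ≤ √(π/a) / c` for `x` on the curve
(`GaussianSchur`).

Only this last estimate uses geometry. Distances in the plane are at least `c` times distances along
the curve, and arc length measure is dominated by the image of Lebesgue measure, so the integral is
at most `∫ exp (-a c² s²) ds` over the line. A loop is unrolled by cutting it opposite to `x`.

For several pieces, the choice `κᵢ = β N / (2 cᵢ)` gives all pieces the same gradient weight `1 / (β
N)`; the weights add up to `β⁻¹` and the mass terms to `β S`. -/

noncomputable section

namespace LeakyWire

open scoped FourierTransform RealInnerProductSpace

/-! ### Closed semibounded forms, the first representation theorem and the spectrum -/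

section FormTheory

variable {H : Type*} [NormedAddCommGroup H] [InnerProductSpace ℂ H]

/-- The domain of a form `q ≥ b`, as a space with the inner product
`q(u, v) + (1 - b) ⟨u, v⟩`. -/
def EnergySpace (q : SymmForm H) (b : ℝ) (_ : ∀ u : q.domain, b * ‖(u : H)‖ ^ 2 ≤ q.quad u) :
    Type _ := q.domain

namespace EnergySpace

variable (q : SymmForm H) (b : ℝ) (hb : ∀ u : q.domain, b * ‖(u : H)‖ ^ 2 ≤ q.quad u)

instance : AddCommGroup (EnergySpace q b hb) := inferInstanceAs (AddCommGroup q.domain)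
instance : Module ℂ (EnergySpace q b hb) := inferInstanceAs (Module ℂ q.domain)

/-- The element of the energy space given by an element of the form domain. -/
def mk : q.domain →ₗ[ℂ] EnergySpace q b hb := LinearMap.id

/-- The element of the form domain underlying an element of the energy space. -/
def val : EnergySpace q b hb →ₗ[ℂ] q.domain := LinearMap.id

theorem val_mk (u : q.domain) : val q b hb (mk q b hb u) = u := rfl

/-- The energy inner product. -/
def energyInner (u v : q.domain) : ℂ := q.form u v + ((1 - b : ℝ) : ℂ) * inner ℂ (u : H) (v : H)

theorem re_energyInner_self (u : q.domain) :
    (energyInner q b u u).re = q.quad u + (1 - b) * ‖(u : H)‖ ^ 2 := by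
  have h : inner ℂ (u : H) (u : H) = ((‖(u : H)‖ ^ 2 : ℝ) : ℂ) := by
    rw [inner_self_eq_norm_sq_to_K]; norm_cast
  simp only [energyInner, h, ← Complex.ofReal_mul, Complex.add_re, Complex.ofReal_re]
  rfl

/-- The energy inner product as an inner product space core. -/
@[reducible] def core : InnerProductSpace.Core ℂ (EnergySpace q b hb) where
  inner u v := energyInner q b (val q b hb u) (val q b hb v)
  conj_inner_symm u v := by
    simp [energyInner, q.symm]
  re_inner_nonneg u := by
    have := re_energyInner_self q b (val q b hb u)
    have h2 := hb (val q b hb u)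
    change 0 ≤ (energyInner q b (val q b hb u) (val q b hb u)).re
    rw [this]
    nlinarith [sq_nonneg ‖((val q b hb u : q.domain) : H)‖]
  add_left u v w := by
    simp only [energyInner, map_add, LinearMap.add_apply, Submodule.coe_add, inner_add_left]
    ring
  smul_left u v a := by
    simp only [energyInner, map_smulₛₗ, LinearMap.smul_apply, Submodule.coe_smul,
      inner_smul_left, smul_eq_mul, RingHom.id_apply]
    ring
  definite u hu := by
    have := re_energyInner_self q b (val q b hb u)
    have h2 := hb (val q b hb u)
    rw [show energyInner q b (val q b hb u) (val q b hb u) = 0 from hu, Complex.zero_re] at this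
    have h3 : ‖((val q b hb u : q.domain) : H)‖ ^ 2 = 0 := by
      nlinarith [sq_nonneg ‖((val q b hb u : q.domain) : H)‖]
    have h4 : ((val q b hb u : q.domain) : H) = 0 := by simpa using h3
    have h5 : (val q b hb u : q.domain) = 0 := Subtype.ext h4
    exact h5

instance : NormedAddCommGroup (EnergySpace q b hb) := (core q b hb).toNormedAddCommGroup
instance : InnerProductSpace ℂ (EnergySpace q b hb) := InnerProductSpace.ofCore (core q b hb).toCore

theorem inner_def (u v : EnergySpace q b hb) :
    inner ℂ u v = energyInner q b (val q b hb u) (val q b hb v) := rfl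

theorem norm_sq (u : EnergySpace q b hb) :
    ‖u‖ ^ 2 = q.quad (val q b hb u) + (1 - b) * ‖((val q b hb u : q.domain) : H)‖ ^ 2 := by
  rw [← re_energyInner_self, ← inner_def, ← inner_self_eq_norm_sq (𝕜 := ℂ)]; rfl

theorem norm_val_le (u : EnergySpace q b hb) : ‖((val q b hb u : q.domain) : H)‖ ≤ ‖u‖ := by
  have h := norm_sq q b hb u
  have h2 := hb (val q b hb u)
  refine le_of_sq_le_sq ?_ (norm_nonneg _)
  nlinarith

/-- The inclusion of the energy space in the ambient space. -/
def incl : EnergySpace q b hb →L[ℂ] H :=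
  LinearMap.mkContinuous (q.domain.subtype ∘ₗ val q b hb) 1 (fun u => by
    simpa using norm_val_le q b hb u)

theorem incl_apply (u : EnergySpace q b hb) : incl q b hb u = (val q b hb u : q.domain) := rfl

/-- The energy norm controls both the ambient norm and `q`, so an energy-Cauchy sequence satisfies
the two hypotheses of closedness; the limit they produce is also the limit in energy norm. -/
theorem completeSpace [CompleteSpace H] (hq : q.IsClosed) : CompleteSpace (EnergySpace q b hb) := by
  refine Metric.complete_of_cauchySeq_tendsto fun u hu => ?_
  obtain ⟨x, hx⟩ := cauchySeq_tendsto_of_complete ((incl q b hb).uniformContinuous.comp_cauchySeq hu)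
  have hd : Tendsto (fun p : ℕ × ℕ => ‖u p.1 - u p.2‖) atTop (𝓝 0) := by
    simpa only [dist_eq_norm] using cauchySeq_iff_tendsto_dist_atTop_0.mp hu
  have hd2 : Tendsto (fun p : ℕ × ℕ => ‖incl q b hb (u p.1 - u p.2)‖) atTop (𝓝 0) :=
    squeeze_zero (fun _ => norm_nonneg _) (fun p => norm_val_le q b hb _) hd
  have hq1 : ∀ w : EnergySpace q b hb,
      q.quad (val q b hb w) = ‖w‖ ^ 2 - (1 - b) * ‖incl q b hb w‖ ^ 2 := fun w => by
    rw [norm_sq, incl_apply]; ring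
  obtain ⟨v, hv, hv2⟩ := hq (fun n => val q b hb (u n)) x hx (by
    have := (hd.pow 2).sub ((hd2.pow 2).const_mul (1 - b))
    simp only [ne_eq, OfNat.ofNat_ne_zero, not_false_eq_true, zero_pow, mul_zero, sub_zero] at this
    refine this.congr fun p => ?_
    rw [← hq1, map_sub])
  refine ⟨mk q b hb v, tendsto_iff_norm_sub_tendsto_zero.mpr ?_⟩
  have h1 : Tendsto (fun n => ‖incl q b hb (u n - mk q b hb v)‖) atTop (𝓝 0) := by
    have := tendsto_iff_norm_sub_tendsto_zero.mp hx
    refine this.congr fun n => ?_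
    rw [map_sub, incl_apply q b hb (mk q b hb v), val_mk, hv]; rfl
  have h2 : Tendsto (fun n => ‖u n - mk q b hb v‖ ^ 2) atTop (𝓝 0) := by
    have := hv2.add ((h1.pow 2).const_mul (1 - b))
    simp only [ne_eq, OfNat.ofNat_ne_zero, not_false_eq_true, zero_pow, mul_zero, add_zero] at this
    refine this.congr fun n => ?_
    rw [norm_sq]; rfl
  have h3 := h2.sqrt
  simpa [Real.sqrt_sq] using h3

end EnergySpace

open EnergySpace in
/-- Solvability of `q(v, u) - z ⟨v, u⟩ = ⟨v, f⟩` for `Re z` below the lower bound of `q`. -/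
theorem SymmForm.exists_solution [CompleteSpace H] (q : SymmForm H) (hq : q.IsClosed) {b : ℝ}
    (hb : ∀ u : q.domain, b * ‖(u : H)‖ ^ 2 ≤ q.quad u) {z : ℂ} (hz : z.re < b) (f : H) :
    ∃ u : q.domain, ∀ v : q.domain, q.form v u - z * inner ℂ (v : H) (u : H) = inner ℂ (v : H) f := by
  have := EnergySpace.completeSpace q b hb hq
  let J := incl q b hb
  -- Lax–Milgram: `T` represents the shifted form `q - z` in the energy inner product. The
  -- subtracted multiple of `J* J` replaces the shift `1 - b` built into that product by `-z`.
  let T : EnergySpace q b hb →L[ℂ] EnergySpace q b hb :=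
    ContinuousLinearMap.id ℂ _ - (((1 - b : ℝ) : ℂ) + z) • (ContinuousLinearMap.adjoint J ∘L J)
  have hT : ∀ v u : EnergySpace q b hb, inner ℂ v (T u) =
      q.form (val q b hb v) (val q b hb u) - z * inner ℂ (J v) (J u) := by
    intro v u
    simp only [T, _root_.sub_apply, _root_.smul_apply, inner_sub_right,
      inner_smul_right, ContinuousLinearMap.comp_apply, ContinuousLinearMap.adjoint_inner_right,
      ContinuousLinearMap.id_apply, inner_def, energyInner]
    simp only [J, incl_apply]
    ring
  -- The energy is `(q[u] - b ‖u‖²) + ‖u‖²`, and the real part of the shifted form is `(q[u] - b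
  -- ‖u‖²) + (b - Re z) ‖u‖²`; comparing coefficients gives `δ`.
  set δ : ℝ := min 1 (b - z.re) with hδ
  have hδ0 : 0 < δ := lt_min one_pos (by linarith)
  have hco : ∀ u, ‖u‖ ^ 2 * δ ≤ ‖inner ℂ (T u) u‖ := by
    intro u
    rw [norm_inner_symm]
    refine le_trans ?_ (Complex.re_le_norm _)
    rw [hT, Complex.sub_re]
    have h : inner ℂ (J u) (J u) = ((‖J u‖ ^ 2 : ℝ) : ℂ) := by
      rw [inner_self_eq_norm_sq_to_K]; norm_cast
    rw [h, Complex.re_mul_ofReal, norm_sq]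
    change _ ≤ q.quad (val q b hb u) - _
    have h1 := hb (val q b hb u)
    have h2 : δ ≤ 1 := min_le_left _ _
    have h3 : δ ≤ b - z.re := min_le_right _ _
    simp only [J, incl_apply]
    set n := ‖((val q b hb u : q.domain) : H)‖ ^ 2 with hn
    have hn0 : 0 ≤ n := sq_nonneg _
    nlinarith [mul_nonneg (sub_nonneg.mpr h2) (sub_nonneg.mpr h1),
      mul_nonneg hn0 (sub_nonneg.mpr h3)]
  have hu : IsUnit T :=
    ContinuousLinearMap.isUnit_of_forall_le_norm_inner_map T (c := ⟨δ, hδ0.le⟩) hδ0 hco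
  obtain ⟨S, hS⟩ := hu
  let u := (↑S⁻¹ : EnergySpace q b hb →L[ℂ] EnergySpace q b hb) (ContinuousLinearMap.adjoint J f)
  have hTu : T u = ContinuousLinearMap.adjoint J f := by
    have := S.mul_inv
    rw [hS] at this
    exact DFunLike.congr_fun this (ContinuousLinearMap.adjoint J f)
  refine ⟨val q b hb u, fun v => ?_⟩
  have := hT (EnergySpace.mk q b hb v) u
  rw [hTu, ContinuousLinearMap.adjoint_inner_right] at this
  exact this.symm

/-- The estimate that gives uniqueness and boundedness of solutions of
`q(v, u) - z ⟨v, u⟩ = ⟨v, f⟩`. -/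
theorem SymmForm.norm_solution_le (q : SymmForm H) {b : ℝ}
    (hb : ∀ u : q.domain, b * ‖(u : H)‖ ^ 2 ≤ q.quad u) {z : ℂ} (hz : z.re < b) {u : q.domain}
    {f : H} (hu : ∀ v : q.domain, q.form v u - z * inner ℂ (v : H) (u : H) = inner ℂ (v : H) f) :
    ‖(u : H)‖ ≤ (b - z.re)⁻¹ * ‖f‖ := by
  -- Test the equation with `v = u`.
  have h := congrArg Complex.re (hu u)
  have h0 : inner ℂ (u : H) (u : H) = ((‖(u : H)‖ ^ 2 : ℝ) : ℂ) := by
    rw [inner_self_eq_norm_sq_to_K]; norm_cast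
  rw [h0, Complex.sub_re, Complex.re_mul_ofReal] at h
  change q.quad u - _ = _ at h
  have h1 := hb u
  have h2 : (inner ℂ (u : H) f).re ≤ ‖(u : H)‖ * ‖f‖ :=
    (Complex.re_le_norm _).trans (norm_inner_le_norm _ _)
  have h3 : 0 < b - z.re := by linarith
  rw [inv_mul_eq_div, le_div_iff₀ h3]
  rcases eq_or_lt_of_le (norm_nonneg (u : H)) with h4 | h4
  · rw [← h4, zero_mul]; exact norm_nonneg _
  · refine le_of_mul_le_mul_left ?_ h4
    nlinarith

/-- The resolvent at `z`, with `Re z` below the lower bound of the form. -/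
theorem SymmForm.exists_solutionOperator [CompleteSpace H] (q : SymmForm H) (hq : q.IsClosed)
    {b : ℝ} (hb : ∀ u : q.domain, b * ‖(u : H)‖ ^ 2 ≤ q.quad u) {z : ℂ} (hz : z.re < b) :
    ∃ R : H →L[ℂ] H, ∀ f u : H, R f = u ↔ ∃ hu : u ∈ q.domain, ∀ v : q.domain,
      q.form v ⟨u, hu⟩ - z * inner ℂ (v : H) u = inner ℂ (v : H) f := by
  choose S hS using q.exists_solution hq hb hz
  have huniq : ∀ (f : H) (u u' : q.domain),
      (∀ v : q.domain, q.form v u - z * inner ℂ (v : H) (u : H) = inner ℂ (v : H) f) →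
      (∀ v : q.domain, q.form v u' - z * inner ℂ (v : H) (u' : H) = inner ℂ (v : H) f) →
      u = u' := by
    intro f u u' hu hu'
    have := q.norm_solution_le hb hz (u := u - u') (f := 0) (fun v => by
      rw [map_sub, Submodule.coe_sub, inner_sub_right, inner_zero_right]
      linear_combination hu v - hu' v)
    rw [norm_zero, mul_zero, norm_le_zero_iff, Submodule.coe_sub, sub_eq_zero] at this
    exact Subtype.ext this
  let R₀ : H →ₗ[ℂ] H :=
    { toFun := fun f => S f
      map_add' := fun f g => by
        rw [← Submodule.coe_add]
        refine congrArg _ (huniq (f + g) _ _ (hS _) fun v => ?_)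
        rw [map_add, Submodule.coe_add, inner_add_right, inner_add_right]
        linear_combination hS f v + hS g v
      map_smul' := fun a f => by
        rw [RingHom.id_apply, ← Submodule.coe_smul]
        refine congrArg _ (huniq (a • f) _ _ (hS _) fun v => ?_)
        rw [map_smul, Submodule.coe_smul, inner_smul_right, inner_smul_right, smul_eq_mul]
        linear_combination a * hS f v }
  refine ⟨R₀.mkContinuous (b - z.re)⁻¹ fun f => q.norm_solution_le hb hz (hS f), fun f u => ?_⟩
  constructor
  · rintro rfl
    exact ⟨(S f).2, hS f⟩
  · rintro ⟨hu, h⟩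
    exact congrArg Subtype.val (huniq f (S f) ⟨u, hu⟩ (hS f) h)

/-- The points below the lower bound of the form are in the resolvent set. -/
theorem SymmForm.IsAssociated.mem_resolventSet [CompleteSpace H] {q : SymmForm H}
    {A : H →ₗ.[ℂ] H} (hA : q.IsAssociated A) (hq : q.IsClosed)
    {b : ℝ} (hb : ∀ u : q.domain, b * ‖(u : H)‖ ^ 2 ≤ q.quad u) {z : ℂ} (hz : z.re < b) :
    z ∈ resolventSet A := by
  obtain ⟨R, hR⟩ := q.exists_solutionOperator hq hb hz
  refine ⟨R, fun y => ?_, fun x => ?_⟩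
  · obtain ⟨hu, h⟩ := (hR y (R y)).mp rfl
    have hg : (R y, z • R y + y) ∈ A.graph := (hA _ _).mpr ⟨hu, fun v => by
      rw [inner_add_right, inner_smul_right, ← h v]; ring⟩
    obtain ⟨w, hw1, hw2⟩ := (LinearPMap.mem_graph_iff A).mp hg
    have hy : R y ∈ A.domain := by
      have h1 := w.2
      rwa [hw1] at h1
    refine ⟨hy, ?_⟩
    have : w = ⟨R y, hy⟩ := Subtype.ext hw1
    rw [← this, hw2]; simp
  · obtain ⟨hu, h⟩ := (hA _ _).mp (LinearPMap.mem_graph A x)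
    exact (hR _ _).mpr ⟨hu, fun v => by rw [h v, inner_sub_right, inner_smul_right]⟩

theorem SymmForm.IsAssociated.eq {q : SymmForm H} {A A' : H →ₗ.[ℂ] H} (hA : q.IsAssociated A)
    (hA' : q.IsAssociated A') : A = A' :=
  LinearPMap.eq_of_eq_graph (by ext ⟨u, f⟩; rw [hA, hA'])

/-- The resolvent of a symmetric operator at a real number is symmetric. -/
theorem inner_resolvent {A : H →ₗ.[ℂ] H} (hsymm : A.IsFormalAdjoint A) {t : ℝ} {R : H →L[ℂ] H}
    (hR : ∀ y : H, ∃ hy : R y ∈ A.domain, A ⟨R y, hy⟩ - (t : ℂ) • R y = y) (f h : H) :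
    inner ℂ (R f) h = inner ℂ f (R h) := by
  obtain ⟨hf1, hf2⟩ := hR f
  obtain ⟨hh1, hh2⟩ := hR h
  calc inner ℂ (R f) h = inner ℂ (R f) (A ⟨R h, hh1⟩ - (t : ℂ) • R h) := by rw [hh2]
    _ = inner ℂ (A ⟨R f, hf1⟩ - (t : ℂ) • R f) (R h) := by
      have := hsymm ⟨R f, hf1⟩ ⟨R h, hh1⟩
      simp only at this
      rw [inner_sub_left, inner_sub_right, this, inner_smul_left, inner_smul_right,
        Complex.conj_ofReal]
    _ = inner ℂ f (R h) := by rw [hf2]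

/-- The first representation theorem: a densely defined closed semibounded form defines a
self-adjoint operator. -/
theorem SymmForm.exists_isSelfAdjoint_isAssociated [CompleteSpace H] (q : SymmForm H)
    (hd : Dense (q.domain : Set H)) (hq : q.IsClosed) (hb : q.IsBoundedBelow) :
    ∃ A : H →ₗ.[ℂ] H, IsSelfAdjoint A ∧ q.IsAssociated A := by
  obtain ⟨b, hb⟩ := hb
  have hzero : ∀ f : H, (∀ v : q.domain, inner ℂ (v : H) f = 0) → f = 0 := fun f hf =>
    hd.eq_zero_of_inner_right ℂ fun v hv => hf ⟨v, hv⟩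
  let g : Submodule ℂ (H × H) :=
    { carrier := {p | ∃ hu : p.1 ∈ q.domain, ∀ v : q.domain,
        q.form v ⟨p.1, hu⟩ = inner ℂ (v : H) p.2}
      add_mem' := by
        rintro ⟨u, f⟩ ⟨u', f'⟩ ⟨hu, h⟩ ⟨hu', h'⟩
        refine ⟨add_mem hu hu', fun v => ?_⟩
        have : (⟨(u, f).1 + (u', f').1, add_mem hu hu'⟩ : q.domain) = ⟨u, hu⟩ + ⟨u', hu'⟩ := rfl
        change q.form v ⟨u + u', _⟩ = inner ℂ (v : H) (f + f')
        rw [inner_add_right, ← h v, ← h' v, ← map_add]; rfl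
      zero_mem' := ⟨q.domain.zero_mem, fun v => by
        change q.form v 0 = inner ℂ (v : H) 0
        simp⟩
      smul_mem' := by
        rintro a ⟨u, f⟩ ⟨hu, h⟩
        refine ⟨q.domain.smul_mem a hu, fun v => ?_⟩
        change q.form v ⟨a • u, _⟩ = inner ℂ (v : H) (a • f)
        rw [inner_smul_right, ← h v, ← smul_eq_mul, ← map_smul]; rfl }
  -- Density of the form domain makes the relation single-valued.
  have hg : ∀ x ∈ g, x.1 = 0 → x.2 = 0 := by
    rintro ⟨u, f⟩ ⟨hu, h⟩ (rfl : u = 0)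
    refine hzero f fun v => ?_
    rw [← h v]
    change q.form v 0 = 0
    simp
  have hA : q.IsAssociated g.toLinearPMap := fun u f => by
    rw [Submodule.toLinearPMap_graph_eq g hg]; rfl
  generalize g.toLinearPMap = A at hA
  refine ⟨A, ?_, hA⟩
  -- Any real point below the bound would do: its resolvent `R` is bounded, everywhere defined and
  -- symmetric, which yields both density of the domain and self-adjointness.
  have hz : (((b - 1 : ℝ) : ℂ)).re < b := by simp
  obtain ⟨R, hR, hR'⟩ := hA.mem_resolventSet hq hb hz
  have hsymm : A.IsFormalAdjoint A := by
    intro x y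
    obtain ⟨hx, hx'⟩ := (hA _ _).mp (LinearPMap.mem_graph A x)
    obtain ⟨hy, hy'⟩ := (hA _ _).mp (LinearPMap.mem_graph A y)
    have h1 := hx' ⟨y, hy⟩
    have h2 := hy' ⟨x, hx⟩
    rw [← inner_conj_symm, ← h1, q.symm, h2]
  have hRsymm := inner_resolvent hsymm hR
  have hdense : Dense (A.domain : Set H) := by
    rw [Submodule.dense_iff_topologicalClosure_eq_top, Submodule.topologicalClosure_eq_top_iff,
      Submodule.eq_bot_iff]
    intro y hy
    -- Since `R (R y)` lies in the domain, `‖R y‖² = ⟨R (R y), y⟩ = 0`.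
    have h1 : R y = 0 := by
      have : inner ℂ (R (R y)) y = 0 := hy _ (hR (R y)).1
      rw [hRsymm] at this
      exact inner_self_eq_zero.mp this
    obtain ⟨h2, h3⟩ := hR y
    rw [← h3]
    have : (⟨R y, h2⟩ : A.domain) = 0 := Subtype.ext h1
    rw [this, h1]; simp
  rw [LinearPMap.isSelfAdjoint_def]
  symm
  refine LinearPMap.eq_of_le_of_domain_eq (hsymm.le_adjoint hdense)
    (le_antisymm (hsymm.le_adjoint hdense).1 fun y hy => ?_)
  have had := LinearPMap.adjoint_isFormalAdjoint hdense
  set w := LinearPMap.adjoint A ⟨y, hy⟩ with hw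
  -- With `t = b - 1`, a vector `y` of the adjoint domain equals `R (A* y - t y)`, so it lies in the
  -- range of `R`, hence in the domain of `A`.
  have hyR : y = R (w - ((b - 1 : ℝ) : ℂ) • y) := by
    refine ext_inner_right ℂ fun h => ?_
    obtain ⟨h1, h2⟩ := hR h
    have h3 := had ⟨y, hy⟩ ⟨R h, h1⟩
    rw [hRsymm, inner_sub_left, inner_smul_left, Complex.conj_ofReal]
    simp only at h3
    rw [hw, h3, ← inner_smul_right, ← inner_sub_right, h2]
  rw [hyR]
  exact (hR _).1

/-- A self-adjoint operator with a real number in its resolvent set, in a non-trivial Hilbert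
space, has non-empty spectrum. -/
theorem spectrum_nonempty [CompleteSpace H] [Nontrivial H] {A : H →ₗ.[ℂ] H} (hA : IsSelfAdjoint A)
    {t : ℝ} (ht : (t : ℂ) ∈ resolventSet A) : (spectrum A).Nonempty := by
  obtain ⟨R, hR, hR'⟩ := ht
  have hsymm : A.IsFormalAdjoint A := by
    have := LinearPMap.adjoint_isFormalAdjoint hA.dense_domain
    rwa [LinearPMap.isSelfAdjoint_def.mp hA] at this
  have hRsymm : IsSelfAdjoint R := by
    rw [ContinuousLinearMap.isSelfAdjoint_iff_isSymmetric]
    exact inner_resolvent hsymm hR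
  have hR0 : R ≠ 0 := by
    rintro rfl
    obtain ⟨y, hy⟩ := exists_ne (0 : H)
    obtain ⟨h1, h2⟩ := hR y
    refine hy ?_
    rw [← h2]
    have : (⟨(0 : H →L[ℂ] H) y, h1⟩ : A.domain) = 0 := Subtype.ext (by simp)
    rw [this]; simp
  -- The spectral radius of a bounded self-adjoint operator is its norm, here non-zero.
  have hex : ∃ k ∈ _root_.spectrum ℂ R, k ≠ 0 := by
    obtain ⟨k, hk, hk'⟩ := _root_.spectrum.exists_nnnorm_eq_spectralRadius R
    refine ⟨k, hk, ?_⟩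
    rintro rfl
    rw [hRsymm.spectralRadius_eq_nnnorm] at hk'
    exact hR0 (by simpa using hk'.symm)
  obtain ⟨k, hk, hk0⟩ := hex
  -- Spectral mapping for `k = 1 / (λ - t)`: if `λ = t + k⁻¹` had a resolvent `S`, then `k - R`
  -- would have the inverse `k⁻¹ (1 + k⁻¹ S)`.
  refine ⟨t + k⁻¹, fun ⟨S, hS, hS'⟩ => ?_⟩
  refine hk ?_
  have hRS : ∀ y, R (k⁻¹ • S y + y) = S y := fun y => by
    obtain ⟨h1, h2⟩ := hS y
    refine Eq.trans (congrArg R ?_) (hR' ⟨S y, h1⟩)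
    rw [sub_eq_iff_eq_add.mp h2]
    simp only [add_smul]; abel
  have hSR : ∀ y, S (y - k⁻¹ • R y) = R y := fun y => by
    obtain ⟨h1, h2⟩ := hR y
    refine Eq.trans (congrArg S ?_) (hS' ⟨R y, h1⟩)
    rw [sub_eq_iff_eq_add.mp h2]
    simp only [add_smul]; abel
  have hinv : ∀ y : H, k • (k⁻¹ • y) = y := fun y => by rw [smul_smul, mul_inv_cancel₀ hk0, one_smul]
  have hinv' : ∀ y : H, k⁻¹ • (k • y) = y := fun y => by
    rw [smul_smul, inv_mul_cancel₀ hk0, one_smul]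
  let U : H →L[ℂ] H := k⁻¹ • (1 + k⁻¹ • S)
  rw [_root_.spectrum.mem_resolventSet_iff, Algebra.algebraMap_eq_smul_one]
  refine isUnit_iff_exists.mpr ⟨U, ?_, ?_⟩
  · ext y
    have h2 := hRS y
    rw [map_add, map_smul] at h2
    change k • (k⁻¹ • (y + k⁻¹ • S y)) - R (k⁻¹ • (y + k⁻¹ • S y)) = y
    rw [hinv, map_smul, map_add, map_smul, add_comm (R y), h2]
    abel
  · ext y
    have h2 := hSR y
    rw [map_sub, map_smul] at h2
    change k⁻¹ • ((k • y - R y) + k⁻¹ • S (k • y - R y)) = y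
    rw [map_sub, map_smul, smul_sub, hinv', sub_add, ← sub_sub_self (R y) (S y - k⁻¹ • S (R y))]
    simp [h2, hinv']

end FormTheory

/-! ### Fourier transforms of measures and Gaussian averages -/

/-- The Fourier transform of the complex measure `φ m`. -/
def measureFourier (m : Measure Plane) (φ : Plane → ℂ) (ξ : Plane) : ℂ :=
  VectorFourier.fourierIntegral Real.fourierChar m (innerₗ Plane) φ ξ

theorem innerₗ_flip : (innerₗ Plane).flip = innerₗ Plane := by
  ext x y : 2; simp

theorem integral_measureFourier_mul (m : Measure Plane) [SigmaFinite m] {φ g : Plane → ℂ} (hφ : Integrable φ m)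
    (hg : Integrable g) :
    ∫ ξ, measureFourier m φ ξ * g ξ = ∫ x, φ x * 𝓕 g x ∂m := by
  have h := VectorFourier.integral_fourierIntegral_smul_eq_flip (L := innerₗ Plane)
    Real.continuous_fourierChar continuous_inner hφ hg
  rw [innerₗ_flip] at h
  exact h

/-- Parseval's identity between `φ m` and a function, a consequence of Fubini. It turns integrals
against `m` into integrals over frequency space and back. -/
theorem integral_conj_measureFourier_mul (m : Measure Plane) [SigmaFinite m] {φ g : Plane → ℂ}
    (hφ : Integrable φ m) (hg : Integrable g) :
    ∫ ξ, (starRingEnd ℂ) (measureFourier m φ ξ) * g ξ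
      = ∫ x, (starRingEnd ℂ) (φ x) * 𝓕⁻ g x ∂m := by
  have h := VectorFourier.integral_sesq_fourierIntegral_eq_neg_flip (innerSL ℂ)
    (L := innerₗ Plane) Real.continuous_fourierChar continuous_inner hφ hg
  rw [innerₗ_flip] at h
  have e : ∀ a b : ℂ, innerSL ℂ a b = (starRingEnd ℂ) a * b := fun a b => by
    rw [innerSL_apply_apply, RCLike.inner_apply, mul_comm]
  simp only [e] at h
  exact h

theorem continuous_measureFourier (m : Measure Plane) {φ : Plane → ℂ} (hφ : Integrable φ m) :
    Continuous (measureFourier m φ) :=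
  VectorFourier.fourierIntegral_continuous Real.continuous_fourierChar continuous_inner hφ

theorem norm_measureFourier_le (m : Measure Plane) (φ : Plane → ℂ) (ξ : Plane) :
    ‖measureFourier m φ ξ‖ ≤ ∫ x, ‖φ x‖ ∂m :=
  VectorFourier.norm_fourierIntegral_le_integral_norm _ _ _ _ _

theorem integrable_gaussian {b : ℝ} (hb : 0 < b) :
    Integrable (fun ξ : Plane => Real.exp (-b * ‖ξ‖ ^ 2)) := by
  have h := GaussianFourier.integrable_cexp_neg_mul_sq_norm_add (V := Plane) (b := b)
    (by simpa using hb) 0 0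
  refine (h.norm).congr (Eventually.of_forall fun ξ => ?_)
  simp only [Complex.norm_exp]
  congr 1
  simp [← Complex.ofReal_pow]

/-- The Gaussian average of `|F|²`, for `F` the Fourier transform of `φ m`, as a double integral
with a Gaussian kernel. -/
theorem lintegral_measureFourier_gaussian_le (m : Measure Plane) [IsFiniteMeasure m]
    {φ : Plane → ℂ} (hφ : Integrable φ m) {a : ℝ} (ha : 0 < a) :
    ∫⁻ ξ, ‖measureFourier m φ ξ‖ₑ ^ 2 * ENNReal.ofReal (Real.exp (-(Real.pi ^ 2 / a) * ‖ξ‖ ^ 2))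
      ≤ ENNReal.ofReal (a / Real.pi) * ∫⁻ x, ∫⁻ y,
        ‖φ x‖ₑ * ‖φ y‖ₑ * ENNReal.ofReal (Real.exp (-a * ‖x - y‖ ^ 2)) ∂m ∂m := by
  set F := measureFourier m φ with hF
  set b : ℝ := Real.pi ^ 2 / a with hb
  have hb0 : 0 < b := by positivity
  set G : Plane → ℝ := fun ξ => Real.exp (-b * ‖ξ‖ ^ 2) with hG
  have hGi : Integrable (fun ξ => (G ξ : ℂ)) := (integrable_gaussian hb0).ofReal
  have hFc : Continuous F := continuous_measureFourier m hφ
  have hFb : ∀ ξ, ‖F ξ‖ ≤ ∫ x, ‖φ x‖ ∂m := norm_measureFourier_le m φ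
  have hFG : Integrable (fun ξ => F ξ * (G ξ : ℂ)) :=
    hGi.bdd_mul hFc.aestronglyMeasurable (Eventually.of_forall hFb)
  have hFFG : Integrable (fun ξ => (starRingEnd ℂ) (F ξ) * (F ξ * (G ξ : ℂ))) :=
    hFG.bdd_mul (c := ∫ x, ‖φ x‖ ∂m) (Complex.continuous_conj.comp hFc).aestronglyMeasurable
      (Eventually.of_forall fun ξ => by simpa using hFb ξ)
  -- The exponent `b = π² / a` is chosen so that the transform of the Gaussian `G` in the plane is
  -- `(a/π) exp (-a |x|²)`; multiplication by `G` then becomes convolution of `φ m` with this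
  -- kernel.
  have hinner : ∀ x, 𝓕⁻ (fun ξ => F ξ * (G ξ : ℂ)) x
      = ∫ y, φ y * (((a / Real.pi : ℝ) : ℂ) * (Real.exp (-a * ‖x - y‖ ^ 2) : ℂ)) ∂m := by
    intro x
    have hg : Integrable fun v : Plane =>
        Complex.exp (-(b : ℂ) * ‖v‖ ^ 2 + 2 * Real.pi * Complex.I * ⟪x, v⟫) :=
      GaussianFourier.integrable_cexp_neg_mul_sq_norm_add (by simpa using hb0) _ _
    have h := integral_measureFourier_mul m hφ hg
    rw [Real.fourierInv_eq']
    have e1 : ∀ v : Plane, Complex.exp (↑(2 * Real.pi * ⟪v, x⟫) * Complex.I) • (F v * (G v : ℂ))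
        = F v * Complex.exp (-(b : ℂ) * ‖v‖ ^ 2 + 2 * Real.pi * Complex.I * ⟪x, v⟫) := by
      intro v
      rw [Complex.exp_add, smul_eq_mul, real_inner_comm]
      simp only [hG]
      push_cast
      ring_nf
    simp only [e1]
    rw [hF, h]
    refine integral_congr_ae (Eventually.of_forall fun y => ?_)
    simp only
    rw [fourier_gaussian_innerProductSpace' (by simpa using hb0)]
    have hpi : (Real.pi : ℂ) ≠ 0 := by exact_mod_cast Real.pi_ne_zero
    have ha' : (a : ℂ) ≠ 0 := by exact_mod_cast ha.ne'
    have e2 : ((Module.finrank ℝ Plane : ℂ) / 2) = 1 := by simp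
    rw [e2, Complex.cpow_one, hb]
    push_cast
    congr 2
    · field_simp
    · congr 1
      field_simp
  have hkey : ENNReal.ofReal (∫ ξ, ‖F ξ‖ ^ 2 * G ξ) = ∫⁻ ξ, ‖F ξ‖ₑ ^ 2 * ENNReal.ofReal (G ξ) := by
    rw [ofReal_integral_eq_lintegral_ofReal]
    · refine lintegral_congr fun ξ => ?_
      rw [ENNReal.ofReal_mul (by positivity), ENNReal.ofReal_pow (norm_nonneg _),
        ofReal_norm]
    · refine hFFG.norm.congr (Eventually.of_forall fun ξ => ?_)
      simp only [norm_mul, RCLike.norm_conj, Complex.norm_real,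
        Real.norm_of_nonneg (Real.exp_pos _).le, hG]
      ring
    · exact Eventually.of_forall fun ξ => mul_nonneg (sq_nonneg _) (Real.exp_pos _).le
  have hkey2 : ENNReal.ofReal (∫ ξ, ‖F ξ‖ ^ 2 * G ξ)
      = ‖∫ ξ, (starRingEnd ℂ) (F ξ) * (F ξ * (G ξ : ℂ))‖ₑ := by
    have : ∀ ξ, (starRingEnd ℂ) (F ξ) * (F ξ * (G ξ : ℂ)) = ((‖F ξ‖ ^ 2 * G ξ : ℝ) : ℂ) := fun ξ => by
      rw [← mul_assoc, Complex.conj_mul']; push_cast; rfl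
    simp only [this]
    rw [integral_complex_ofReal, ← ofReal_norm, Complex.norm_real, Real.norm_of_nonneg]
    exact integral_nonneg fun ξ => mul_nonneg (sq_nonneg _) (Real.exp_pos _).le
  -- Split `|F|² G` as `conj F · (F G)` and move the first transform onto the second factor.
  rw [← hkey, hkey2, hF, integral_conj_measureFourier_mul m hφ hFG]
  refine (enorm_integral_le_lintegral_enorm _).trans ?_
  rw [← lintegral_const_mul' _ _ ENNReal.ofReal_ne_top]
  refine lintegral_mono fun x => ?_
  rw [enorm_mul, RCLike.enorm_conj, hinner]
  refine (mul_le_mul_right (enorm_integral_le_lintegral_enorm _) _).trans ?_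
  rw [← lintegral_const_mul' _ _ ENNReal.ofReal_ne_top, ← lintegral_const_mul' _ _ enorm_ne_top]
  refine lintegral_mono fun y => le_of_eq ?_
  rw [enorm_mul, enorm_mul, ← ofReal_norm (_ : ℂ), ← ofReal_norm (_ : ℂ),
    ← ofReal_norm (_ : ℂ), ← ofReal_norm (_ : ℂ), Complex.norm_real,
    Complex.norm_real, Real.norm_of_nonneg (Real.exp_pos _).le, Real.norm_of_nonneg (by positivity)]
  ring

/-! ### The Schur test and the Birman–Schwinger bound -/

/-- The Gaussian Schur bound: for almost all `x`, the integral of the Gaussian centred at `x` is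
at most the one for the Lebesgue measure on a line, divided by `c`. -/
def GaussianSchur (m : Measure Plane) (c : ℝ) : Prop :=
  ∀ a : ℝ, 0 < a → ∀ᵐ x ∂m, ∫⁻ y, ENNReal.ofReal (Real.exp (-a * ‖x - y‖ ^ 2)) ∂m
    ≤ ENNReal.ofReal (√(Real.pi / a) / c)

/-- The Schur test for the Gaussian kernel. -/
theorem GaussianSchur.lintegral_lintegral_le {m : Measure Plane} [IsFiniteMeasure m] {c : ℝ}
    (hm : GaussianSchur m c) {φ : Plane → ℂ} (hφ : Measurable φ) {a : ℝ} (ha : 0 < a) :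
    ∫⁻ x, ∫⁻ y, ‖φ x‖ₑ * ‖φ y‖ₑ * ENNReal.ofReal (Real.exp (-a * ‖x - y‖ ^ 2)) ∂m ∂m
      ≤ ENNReal.ofReal (√(Real.pi / a) / c) * ∫⁻ x, ‖φ x‖ₑ ^ 2 ∂m := by
  set k : Plane → Plane → ℝ≥0∞ := fun x y => ENNReal.ofReal (Real.exp (-a * ‖x - y‖ ^ 2)) with hk
  have hkm : Measurable (Function.uncurry k) := by
    have : Continuous (Function.uncurry k) := by
      simp only [hk, Function.uncurry_def]
      exact ENNReal.continuous_ofReal.comp (by fun_prop)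
    exact this.measurable
  have hφe : Measurable fun x => ‖φ x‖ₑ := hφ.enorm
  have hks : ∀ x y, k x y = k y x := fun x y => by simp only [hk]; rw [norm_sub_rev]
  have h1 : ∫⁻ x, ∫⁻ y, ‖φ x‖ₑ ^ 2 * k x y ∂m ∂m
      ≤ ENNReal.ofReal (√(Real.pi / a) / c) * ∫⁻ x, ‖φ x‖ₑ ^ 2 ∂m := by
    rw [← lintegral_const_mul' _ _ ENNReal.ofReal_ne_top]
    refine lintegral_mono_ae ?_
    filter_upwards [hm a ha] with x hx
    rw [lintegral_const_mul' _ _ (by simp), mul_comm]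
    exact mul_le_mul_left hx _
  have h2 : ∫⁻ x, ∫⁻ y, ‖φ y‖ₑ ^ 2 * k x y ∂m ∂m = ∫⁻ x, ∫⁻ y, ‖φ x‖ₑ ^ 2 * k x y ∂m ∂m := by
    rw [lintegral_lintegral_swap]
    · simp only [hks]
    · exact (((hφe.comp measurable_snd).pow_const 2).mul hkm).aemeasurable
  -- With `2 |φ(x)| |φ(y)| ≤ |φ(x)|² + |φ(y)|²` and a symmetric kernel, only the marginal integral
  -- of the kernel enters.
  have h3 : ∀ x y, 2 * (‖φ x‖ₑ * ‖φ y‖ₑ * k x y) ≤ ‖φ x‖ₑ ^ 2 * k x y + ‖φ y‖ₑ ^ 2 * k x y := by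
    intro x y
    rw [← add_mul, ← mul_assoc]
    refine mul_le_mul_left ?_ _
    rw [← ofReal_norm, ← ofReal_norm, ← ENNReal.ofReal_mul (norm_nonneg _),
      ← ENNReal.ofReal_pow (norm_nonneg _), ← ENNReal.ofReal_pow (norm_nonneg _),
      ← ENNReal.ofReal_add (by positivity) (by positivity),
      show (2 : ℝ≥0∞) = ENNReal.ofReal 2 by simp, ← ENNReal.ofReal_mul (by norm_num)]
    exact ENNReal.ofReal_le_ofReal (by nlinarith [sq_nonneg (‖φ x‖ - ‖φ y‖)])
  have h4 : 2 * ∫⁻ x, ∫⁻ y, ‖φ x‖ₑ * ‖φ y‖ₑ * k x y ∂m ∂m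
      ≤ 2 * (ENNReal.ofReal (√(Real.pi / a) / c) * ∫⁻ x, ‖φ x‖ₑ ^ 2 ∂m) := by
    calc 2 * ∫⁻ x, ∫⁻ y, ‖φ x‖ₑ * ‖φ y‖ₑ * k x y ∂m ∂m
        = ∫⁻ x, ∫⁻ y, 2 * (‖φ x‖ₑ * ‖φ y‖ₑ * k x y) ∂m ∂m := by
          rw [← lintegral_const_mul' _ _ (by simp)]
          refine lintegral_congr fun x => ?_
          rw [← lintegral_const_mul' _ _ (by simp)]
      _ ≤ ∫⁻ x, ∫⁻ y, (‖φ x‖ₑ ^ 2 * k x y + ‖φ y‖ₑ ^ 2 * k x y) ∂m ∂m :=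
          lintegral_mono fun x => lintegral_mono fun y => h3 x y
      _ = ∫⁻ x, ((∫⁻ y, ‖φ x‖ₑ ^ 2 * k x y ∂m) + ∫⁻ y, ‖φ y‖ₑ ^ 2 * k x y ∂m) ∂m := by
          refine lintegral_congr fun x => lintegral_add_left ?_ _
          exact measurable_const.mul (hkm.comp measurable_prodMk_left)
      _ = (∫⁻ x, ∫⁻ y, ‖φ x‖ₑ ^ 2 * k x y ∂m ∂m) + ∫⁻ x, ∫⁻ y, ‖φ y‖ₑ ^ 2 * k x y ∂m ∂m := by
          refine lintegral_add_left ?_ _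
          exact (((hφe.comp measurable_fst).pow_const 2).mul hkm).lintegral_prod_right'
      _ ≤ _ := by rw [h2, two_mul]; gcongr
  exact (ENNReal.mul_le_mul_iff_right (by simp) (by simp)).mp h4

theorem lintegral_rpow_mul_exp_neg_mul_Ioi {a r : ℝ} (ha : 0 < a) (hr : 0 < r) :
    ∫⁻ t in Ioi (0 : ℝ), ENNReal.ofReal (t ^ (a - 1) * Real.exp (-(r * t)))
      = ENNReal.ofReal ((1 / r) ^ a * Real.Gamma a) := by
  have h := Real.integral_rpow_mul_exp_neg_mul_Ioi ha hr
  rw [← h, ofReal_integral_eq_lintegral_ofReal]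
  · refine Integrable.of_integral_ne_zero ?_
    rw [h]
    have := Real.Gamma_pos_of_pos ha
    positivity
  · filter_upwards [ae_restrict_mem measurableSet_Ioi] with t ht
    exact mul_nonneg (Real.rpow_nonneg (le_of_lt ht) _) (Real.exp_pos _).le

theorem lintegral_exp_neg_mul_Ioi {r : ℝ} (hr : 0 < r) :
    ∫⁻ t in Ioi (0 : ℝ), ENNReal.ofReal (Real.exp (-(r * t))) = ENNReal.ofReal (1 / r) := by
  simpa using lintegral_rpow_mul_exp_neg_mul_Ioi one_pos hr

/-- With `a = 1 / (4t)` the integrand is `exp (-κ² t) / (2 c √(π t))`, and the factor `√π` of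
`Γ(1/2)` cancels. -/
theorem lintegral_heatKernel_Ioi {c κ : ℝ} (hκ : 0 < κ) (hc : 0 < c) :
    ∫⁻ t in Ioi (0 : ℝ), ENNReal.ofReal (Real.exp (-(κ ^ 2 * t)) *
      ((1 / (4 * t)) / Real.pi * (√(Real.pi / (1 / (4 * t))) / c)))
      = ENNReal.ofReal (1 / (2 * κ * c)) := by
  have h := lintegral_rpow_mul_exp_neg_mul_Ioi (a := 1 / 2) (by norm_num) (sq_pos_of_pos hκ)
  have h2 : ENNReal.ofReal (1 / (2 * κ * c)) = ENNReal.ofReal (1 / (√Real.pi * 2 * c)) *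
      ENNReal.ofReal ((1 / κ ^ 2) ^ (1 / 2 : ℝ) * Real.Gamma (1 / 2)) := by
    rw [← ENNReal.ofReal_mul (by positivity), Real.Gamma_one_half_eq, ← Real.sqrt_eq_rpow,
      Real.sqrt_div zero_le_one, Real.sqrt_one, Real.sqrt_sq hκ.le]
    congr 1
    have : √Real.pi ≠ 0 := (Real.sqrt_pos.mpr Real.pi_pos).ne'
    field_simp
  rw [h2, ← h, ← lintegral_const_mul' _ _ ENNReal.ofReal_ne_top]
  refine setLIntegral_congr_fun measurableSet_Ioi fun t ht => ?_
  have ht : 0 < t := ht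
  rw [← ENNReal.ofReal_mul (by positivity)]
  congr 1
  have e1 : √(Real.pi / (1 / (4 * t))) = 2 * √Real.pi * √t := by
    rw [show Real.pi / (1 / (4 * t)) = (2 ^ 2 * Real.pi) * t by field_simp; norm_num,
      Real.sqrt_mul (by positivity), Real.sqrt_mul (by positivity), Real.sqrt_sq (by norm_num)]
  have e2 : t ^ ((1 / 2 : ℝ) - 1) = √t / t := by
    rw [Real.rpow_sub ht, Real.rpow_one, ← Real.sqrt_eq_rpow]
  rw [e1, e2]
  have hp : √Real.pi ≠ 0 := (Real.sqrt_pos.mpr Real.pi_pos).ne'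
  have hp2 : Real.pi = √Real.pi * √Real.pi := (Real.mul_self_sqrt Real.pi_pos.le).symm
  nth_rewrite 1 [hp2]
  field_simp
  norm_num

/-- The Birman–Schwinger bound: the energy of the potential of `φ m`. -/
theorem GaussianSchur.lintegral_measureFourier_le {m : Measure Plane} [IsFiniteMeasure m] {c κ : ℝ}
    (hm : GaussianSchur m c) (hκ : 0 < κ) (hc : 0 < c) {φ : Plane → ℂ} (hφ : Measurable φ)
    (hφi : Integrable φ m) :
    ∫⁻ ξ, ‖measureFourier m φ ξ‖ₑ ^ 2 *
        ENNReal.ofReal (1 / (4 * Real.pi ^ 2 * ‖ξ‖ ^ 2 + κ ^ 2))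
      ≤ ENNReal.ofReal (1 / (2 * κ * c)) * ∫⁻ x, ‖φ x‖ₑ ^ 2 ∂m := by
  set F := measureFourier m φ with hF
  set X := ∫⁻ x, ‖φ x‖ₑ ^ 2 ∂m with hX
  have hFc : Continuous F := continuous_measureFourier m hφi
  have hFm : Measurable fun ξ => ‖F ξ‖ₑ ^ 2 := hFc.measurable.enorm.pow_const 2
  -- Laplace representation `1/w = ∫ exp (-w t) dt`. For fixed `t`, the factor `exp (-4π² |ξ|² t)`
  -- is the Gaussian weight with parameter `a = 1 / (4t)`.
  calc ∫⁻ ξ, ‖F ξ‖ₑ ^ 2 * ENNReal.ofReal (1 / (4 * Real.pi ^ 2 * ‖ξ‖ ^ 2 + κ ^ 2))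
      = ∫⁻ ξ, ∫⁻ t in Ioi (0 : ℝ), ‖F ξ‖ₑ ^ 2 *
          ENNReal.ofReal (Real.exp (-((4 * Real.pi ^ 2 * ‖ξ‖ ^ 2 + κ ^ 2) * t))) := by
        refine lintegral_congr fun ξ => ?_
        rw [lintegral_const_mul' _ _ (by simp), lintegral_exp_neg_mul_Ioi (by positivity)]
    _ = ∫⁻ t in Ioi (0 : ℝ), ∫⁻ ξ, ‖F ξ‖ₑ ^ 2 *
          ENNReal.ofReal (Real.exp (-((4 * Real.pi ^ 2 * ‖ξ‖ ^ 2 + κ ^ 2) * t))) := by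
        refine lintegral_lintegral_swap (Measurable.aemeasurable ?_)
        refine (hFm.comp measurable_fst).mul (Continuous.measurable ?_)
        exact ENNReal.continuous_ofReal.comp (by fun_prop)
    _ ≤ ∫⁻ t in Ioi (0 : ℝ), X * ENNReal.ofReal (Real.exp (-(κ ^ 2 * t)) *
          ((1 / (4 * t)) / Real.pi * (√(Real.pi / (1 / (4 * t))) / c))) := by
        refine setLIntegral_mono' measurableSet_Ioi fun t ht => ?_
        have ht : 0 < t := ht
        have ha : 0 < 1 / (4 * t) := by positivity
        calc ∫⁻ ξ, ‖F ξ‖ₑ ^ 2 *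
              ENNReal.ofReal (Real.exp (-((4 * Real.pi ^ 2 * ‖ξ‖ ^ 2 + κ ^ 2) * t)))
            = ENNReal.ofReal (Real.exp (-(κ ^ 2 * t))) * ∫⁻ ξ, ‖F ξ‖ₑ ^ 2 *
              ENNReal.ofReal (Real.exp (-(Real.pi ^ 2 / (1 / (4 * t))) * ‖ξ‖ ^ 2)) := by
              rw [← lintegral_const_mul' _ _ ENNReal.ofReal_ne_top]
              refine lintegral_congr fun ξ => ?_
              rw [mul_left_comm, ← ENNReal.ofReal_mul (Real.exp_pos _).le, ← Real.exp_add]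
              congr 3
              field_simp
              ring
          _ ≤ ENNReal.ofReal (Real.exp (-(κ ^ 2 * t))) *
              (ENNReal.ofReal ((1 / (4 * t)) / Real.pi) *
                (ENNReal.ofReal (√(Real.pi / (1 / (4 * t))) / c) * X)) := by
              gcongr
              refine (lintegral_measureFourier_gaussian_le m hφi ha).trans ?_
              gcongr
              exact hm.lintegral_lintegral_le hφ ha
          _ = _ := by
              rw [ENNReal.ofReal_mul (Real.exp_pos _).le, ENNReal.ofReal_mul (by positivity)]
              ring
    _ = ENNReal.ofReal (1 / (2 * κ * c)) * X := by
        rw [lintegral_const_mul, lintegral_heatKernel_Ioi hκ hc, mul_comm]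
        fun_prop

/-! ### The trace inequality for Schwartz functions -/

/-- The energy `‖∇φ‖² + κ² ‖φ‖²`, on the Fourier side. -/
def fourierEnergy (κ : ℝ) (φ : 𝓢(Plane, ℂ)) : ℝ≥0∞ :=
  ∫⁻ ξ, ENNReal.ofReal (4 * Real.pi ^ 2 * ‖ξ‖ ^ 2 + κ ^ 2) * ‖𝓕 φ ξ‖ₑ ^ 2

/-- Duality: `∫ |φ|² dm` is the pairing of the transform of `φ m` with `𝓕 φ`. Weighted
Cauchy–Schwarz and the Birman–Schwinger bound estimate it by the quantity itself and the energy.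
Finiteness of `m` makes `φ` integrable and allows the quantity to be cancelled. -/
theorem GaussianSchur.lintegral_schwartz_le_of_finite {m : Measure Plane} [IsFiniteMeasure m]
    {c κ : ℝ} (hm : GaussianSchur m c) (hκ : 0 < κ) (hc : 0 < c) (φ : 𝓢(Plane, ℂ)) :
    ∫⁻ x, ‖φ x‖ₑ ^ 2 ∂m ≤ ENNReal.ofReal (1 / (2 * κ * c)) * fourierEnergy κ φ := by
  set X := ∫⁻ x, ‖φ x‖ₑ ^ 2 ∂m with hX
  set F := measureFourier m φ with hF
  obtain ⟨C, hC⟩ : ∃ C, ∀ x, ‖φ x‖ ≤ C := by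
    obtain ⟨C, hC⟩ := φ.decay 0 0
    exact ⟨C, fun x => by simpa using hC.2 x⟩
  have hφi : Integrable φ m :=
    Integrable.of_bound φ.continuous.aestronglyMeasurable C (Eventually.of_forall hC)
  have hsq : Integrable (fun x => ‖φ x‖ ^ 2) m :=
    Integrable.of_bound (φ.continuous.norm.pow 2).aestronglyMeasurable (C ^ 2)
      (Eventually.of_forall fun x => by
        rw [norm_pow, norm_norm]; exact pow_le_pow_left₀ (norm_nonneg _) (hC x) 2)
  have hXr : X = ENNReal.ofReal (∫ x, ‖φ x‖ ^ 2 ∂m) := by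
    rw [ofReal_integral_eq_lintegral_ofReal hsq (Eventually.of_forall fun x => sq_nonneg _)]
    refine lintegral_congr fun x => ?_
    rw [ENNReal.ofReal_pow (norm_nonneg _), ofReal_norm]
  have hXtop : X ≠ ∞ := by rw [hXr]; exact ENNReal.ofReal_ne_top
  set β : ℝ := 1 / (2 * κ * c) with hβ
  have hβ0 : 0 < β := by positivity
  have hinv : 𝓕⁻ (𝓕 (φ : Plane → ℂ)) = φ := by
    have h := FourierTransform.fourierInv_fourier_eq (F := 𝓢(Plane, ℂ)) φ
    ext x
    rw [← SchwartzMap.fourier_coe, ← SchwartzMap.fourierInv_coe, h]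
  have hFi : Integrable (𝓕 (φ : Plane → ℂ)) := by
    rw [← SchwartzMap.fourier_coe]; exact (𝓕 φ).integrable
  have hA : X = ‖∫ ξ, (starRingEnd ℂ) (F ξ) * 𝓕 (φ : Plane → ℂ) ξ‖ₑ := by
    rw [hF, integral_conj_measureFourier_mul m hφi hFi, hinv]
    simp only [Complex.conj_mul']
    rw [hXr, ← ofReal_norm]
    simp only [← Complex.ofReal_pow]
    rw [integral_complex_ofReal, Complex.norm_real, Real.norm_of_nonneg]
    exact integral_nonneg fun x => sq_nonneg _
  -- Young's inequality, with the parameter equal to the Birman–Schwinger constant `β`, so that the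
  -- first term integrates to at most `X`.
  have hpt : ∀ ξ : Plane, 2 * (‖F ξ‖ₑ * ‖𝓕 φ ξ‖ₑ) ≤
      ENNReal.ofReal β⁻¹ * (‖F ξ‖ₑ ^ 2 *
        ENNReal.ofReal (1 / (4 * Real.pi ^ 2 * ‖ξ‖ ^ 2 + κ ^ 2))) +
      ENNReal.ofReal β * (ENNReal.ofReal (4 * Real.pi ^ 2 * ‖ξ‖ ^ 2 + κ ^ 2) * ‖𝓕 φ ξ‖ₑ ^ 2) := by
    intro ξ
    set w : ℝ := 4 * Real.pi ^ 2 * ‖ξ‖ ^ 2 + κ ^ 2 with hw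
    have hw0 : 0 < w := by positivity
    rw [two_mul, ← ofReal_norm, ← ofReal_norm,
      ← ENNReal.ofReal_pow (norm_nonneg _), ← ENNReal.ofReal_pow (norm_nonneg _),
      ← ENNReal.ofReal_mul (by positivity), ← ENNReal.ofReal_add (by positivity) (by positivity),
      ← ENNReal.ofReal_mul (by positivity), ← ENNReal.ofReal_mul (by positivity),
      ← ENNReal.ofReal_mul (by positivity), ← ENNReal.ofReal_mul (by positivity),
      ← ENNReal.ofReal_add (by positivity) (by positivity)]
    refine ENNReal.ofReal_le_ofReal ?_
    have : β⁻¹ * (‖F ξ‖ ^ 2 * (1 / w)) + β * (w * ‖𝓕 φ ξ‖ ^ 2) - 2 * (‖F ξ‖ * ‖𝓕 φ ξ‖)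
        = β⁻¹ * (1 / w) * (‖F ξ‖ - β * w * ‖𝓕 φ ξ‖) ^ 2 := by
      field_simp
      ring
    have h2 : 0 ≤ β⁻¹ * (1 / w) * (‖F ξ‖ - β * w * ‖𝓕 φ ξ‖) ^ 2 := by positivity
    linarith
  have hB : 2 * X ≤ X + ENNReal.ofReal β * fourierEnergy κ φ := by
    have hFc : Continuous F := continuous_measureFourier m hφi
    calc 2 * X ≤ 2 * ∫⁻ ξ, ‖F ξ‖ₑ * ‖𝓕 φ ξ‖ₑ := by
          rw [hA]
          gcongr
          refine (enorm_integral_le_lintegral_enorm _).trans (lintegral_mono fun ξ => le_of_eq ?_)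
          rw [enorm_mul, RCLike.enorm_conj, SchwartzMap.fourier_coe]
      _ = ∫⁻ ξ, 2 * (‖F ξ‖ₑ * ‖𝓕 φ ξ‖ₑ) := by rw [lintegral_const_mul' _ _ (by simp)]
      _ ≤ ∫⁻ ξ, (ENNReal.ofReal β⁻¹ * (‖F ξ‖ₑ ^ 2 *
            ENNReal.ofReal (1 / (4 * Real.pi ^ 2 * ‖ξ‖ ^ 2 + κ ^ 2))) +
          ENNReal.ofReal β * (ENNReal.ofReal (4 * Real.pi ^ 2 * ‖ξ‖ ^ 2 + κ ^ 2) *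
            ‖𝓕 φ ξ‖ₑ ^ 2)) := lintegral_mono hpt
      _ = ENNReal.ofReal β⁻¹ * (∫⁻ ξ, ‖F ξ‖ₑ ^ 2 *
            ENNReal.ofReal (1 / (4 * Real.pi ^ 2 * ‖ξ‖ ^ 2 + κ ^ 2))) +
          ENNReal.ofReal β * fourierEnergy κ φ := by
          rw [lintegral_add_right', lintegral_const_mul' _ _ ENNReal.ofReal_ne_top,
            lintegral_const_mul' _ _ ENNReal.ofReal_ne_top, fourierEnergy]
          have h1 := (𝓕 φ).continuous.measurable
          fun_prop
      _ ≤ ENNReal.ofReal β⁻¹ * (ENNReal.ofReal β * X) + ENNReal.ofReal β * fourierEnergy κ φ := by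
          gcongr
          exact hm.lintegral_measureFourier_le hκ hc φ.continuous.measurable hφi
      _ = X + ENNReal.ofReal β * fourierEnergy κ φ := by
          rw [← mul_assoc, ← ENNReal.ofReal_mul (by positivity), inv_mul_cancel₀ hβ0.ne',
            ENNReal.ofReal_one, one_mul]
  rw [two_mul] at hB
  exact (ENNReal.add_le_add_iff_left hXtop).mp hB

theorem GaussianSchur.mono {m m' : Measure Plane} {c : ℝ} (hm : GaussianSchur m c) (h : m' ≤ m) :
    GaussianSchur m' c := fun a ha =>
  (Measure.absolutelyContinuous_of_le h).ae_le
    ((hm a ha).mono fun _ hx => (lintegral_mono' h le_rfl).trans hx)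

/-- If the ball is not null, it contains a point where the Schur bound with `a = 1` holds. The
Gaussian centred there is at least `exp (-(2r)²)` on the whole ball. -/
theorem GaussianSchur.measure_ball_lt_top {m : Measure Plane} {c : ℝ} (hm : GaussianSchur m c)
    (r : ℝ) : m (Metric.ball 0 r) < ∞ := by
  by_cases h0 : m (Metric.ball 0 r) = 0
  · simp [h0]
  have h1 : ∃ᵐ x ∂m, x ∈ Metric.ball (0 : Plane) r := by
    intro h
    rw [ae_iff] at h
    simp only [not_not, ofPred_mem_eq] at h
    exact h0 h
  obtain ⟨x, hx, hx2⟩ := (h1.and_eventually (hm 1 one_pos)).exists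
  have hr : 0 < Real.exp (-1 * (2 * r) ^ 2) := Real.exp_pos _
  have h3 : ENNReal.ofReal (Real.exp (-1 * (2 * r) ^ 2)) * m (Metric.ball 0 r)
      ≤ ENNReal.ofReal (√(Real.pi / 1) / c) := by
    refine le_trans ?_ hx2
    rw [← setLIntegral_const]
    refine (setLIntegral_mono' measurableSet_ball fun y hy => ?_).trans
      (setLIntegral_le_lintegral _ _)
    refine ENNReal.ofReal_le_ofReal (Real.exp_le_exp.mpr ?_)
    have h4 : ‖x - y‖ ≤ 2 * r := by
      have := norm_sub_le x y
      rw [mem_ball_zero_iff] at hx hy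
      linarith
    nlinarith [norm_nonneg (x - y)]
  by_contra h5
  rw [not_lt, top_le_iff] at h5
  rw [h5, ENNReal.mul_top (by simpa using hr)] at h3
  exact absurd h3 (by simp)

/-- The trace inequality for Schwartz functions. -/
theorem GaussianSchur.lintegral_schwartz_le {m : Measure Plane} {c κ : ℝ}
    (hm : GaussianSchur m c) (hκ : 0 < κ) (hc : 0 < c) (φ : 𝓢(Plane, ℂ)) :
    ∫⁻ x, ‖φ x‖ₑ ^ 2 ∂m ≤ ENNReal.ofReal (1 / (2 * κ * c)) * fourierEnergy κ φ := by
  -- The measure may be infinite; exhaust the plane by balls, on which it is finite.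
  have hun : ⋃ n : ℕ, Metric.ball (0 : Plane) n = univ := Metric.iUnion_ball_nat 0
  have hdir : Directed (· ⊆ ·) fun n : ℕ => Metric.ball (0 : Plane) n :=
    Monotone.directed_le fun i j hij => Metric.ball_subset_ball (by exact_mod_cast hij)
  rw [← setLIntegral_univ, ← hun, setLIntegral_iUnion_of_directed _ hdir]
  refine iSup_le fun n => ?_
  have : IsFiniteMeasure (m.restrict (Metric.ball (0 : Plane) n)) :=
    ⟨by simpa using hm.measure_ball_lt_top n⟩
  exact (hm.mono Measure.restrict_le_self).lintegral_schwartz_le_of_finite hκ hc φ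

/-- Plancherel's theorem for the `H¹` energy of a Schwartz function. -/
theorem fourierEnergy_eq (κ : ℝ) (φ : 𝓢(Plane, ℂ)) :
    fourierEnergy κ φ = ENNReal.ofReal
      (∑ j, ‖schwartzToL2 (∂_{(EuclideanSpace.single j (1 : ℝ) : Plane)} φ)‖ ^ 2
        + κ ^ 2 * ‖schwartzToL2 φ‖ ^ 2) := by
  have hn : ∀ ψ : 𝓢(Plane, ℂ), ENNReal.ofReal (‖schwartzToL2 ψ‖ ^ 2) = ∫⁻ ξ, ‖𝓕 ψ ξ‖ₑ ^ 2 := by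
    intro ψ
    rw [schwartzToL2, ← SchwartzMap.norm_fourier_toL2_eq, ENNReal.ofReal_pow (norm_nonneg _),
      ofReal_norm, Lp.enorm_def, eLpNorm_congr_ae (SchwartzMap.coeFn_toLp _ _ _),
      eLpNorm_eq_lintegral_rpow_enorm_toReal (by simp) (by simp)]
    simp only [ENNReal.toReal_ofNat, ENNReal.rpow_ofNat]
    rw [← ENNReal.rpow_natCast, ← ENNReal.rpow_mul]
    norm_num
  rw [ENNReal.ofReal_add (by positivity) (by positivity),
    ENNReal.ofReal_sum_of_nonneg (fun _ _ => by positivity), ENNReal.ofReal_mul (by positivity)]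
  simp only [hn]
  have hme : ∀ ψ : 𝓢(Plane, ℂ), Measurable fun ξ => ‖ψ ξ‖ₑ ^ 2 := fun ψ =>
    ψ.continuous.measurable.enorm.pow_const 2
  rw [← lintegral_finsetSum _ fun j _ => hme _, ← lintegral_const_mul _ (hme _),
    ← lintegral_add_right _ ((hme _).const_mul _), fourierEnergy]
  refine lintegral_congr fun ξ => ?_
  have hd : ∀ j, ‖𝓕 (∂_{(EuclideanSpace.single j (1 : ℝ) : Plane)} φ) ξ‖ₑ ^ 2
      = ENNReal.ofReal (4 * Real.pi ^ 2 * (ξ j) ^ 2) * ‖𝓕 φ ξ‖ₑ ^ 2 := by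
    intro j
    have ht : (fun x : Plane => inner ℝ x (EuclideanSpace.single j (1 : ℝ))).HasTemperateGrowth := by
      fun_prop
    rw [SchwartzMap.fourier_lineDerivOp_eq, _root_.smul_apply,
      SchwartzMap.smulLeftCLM_apply_apply ht, enorm_smul, enorm_smul, mul_pow, mul_pow, ← mul_assoc]
    congr 1
    rw [← ofReal_norm, ← ofReal_norm, ← ENNReal.ofReal_pow (norm_nonneg _),
      ← ENNReal.ofReal_pow (norm_nonneg _), ← ENNReal.ofReal_mul (by positivity)]
    congr 1
    simp only [Complex.norm_mul, Complex.norm_ofNat, Complex.norm_real, Real.norm_eq_abs,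
      Complex.norm_I, mul_one, EuclideanSpace.inner_single_right, mul_pow, sq_abs, one_mul,
      conj_trivial]
    norm_num
  simp only [hd]
  rw [← Finset.sum_mul, ← add_mul, ← ENNReal.ofReal_sum_of_nonneg (fun _ _ => by positivity),
    ← ENNReal.ofReal_add (Finset.sum_nonneg fun _ _ => by positivity) (by positivity),
    ← Finset.mul_sum, EuclideanSpace.norm_sq_eq]
  simp

/-! ### The Hilbert space `H¹`, closedness of the form, density of Schwartz functions -/

/-- The unit vector in the direction `j`. -/
abbrev axis (j : Fin 2) : Plane := EuclideanSpace.single j (1 : ℝ)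

/-- The complex conjugate of a Schwartz function. -/
def conjSchwartz (φ : 𝓢(Plane, ℂ)) : 𝓢(Plane, ℂ) :=
  SchwartzMap.postcompCLM (𝕜 := ℝ) (Complex.conjCLE : ℂ →L[ℝ] ℂ) φ

theorem conjSchwartz_apply (φ : 𝓢(Plane, ℂ)) (x : Plane) :
    conjSchwartz φ x = (starRingEnd ℂ) (φ x) := rfl

theorem lineDeriv_conjSchwartz (e : Plane) (φ : 𝓢(Plane, ℂ)) :
    ∂_{e} (conjSchwartz φ) = conjSchwartz (∂_{e} φ) := by
  ext x
  rw [conjSchwartz_apply, SchwartzMap.lineDerivOp_apply_eq_fderiv,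
    SchwartzMap.lineDerivOp_apply_eq_fderiv]
  have h : HasFDerivAt (conjSchwartz φ)
      ((Complex.conjCLE : ℂ →L[ℝ] ℂ) ∘L fderiv ℝ φ x) x :=
    (Complex.conjCLE : ℂ →L[ℝ] ℂ).hasFDerivAt.comp x φ.differentiableAt.hasFDerivAt
  rw [h.fderiv]
  rfl

/-- The inner product is antilinear in its first argument and the distributional pairing is
bilinear; hence the conjugate. -/
theorem inner_schwartzToL2 (φ : 𝓢(Plane, ℂ)) (u : L2) :
    inner ℂ (schwartzToL2 φ) u = (u : 𝓢'(Plane, ℂ)) (conjSchwartz φ) := by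
  rw [L2.inner_def, Lp.toTemperedDistribution_apply]
  refine integral_congr_ae ?_
  filter_upwards [SchwartzMap.coeFn_toLp φ 2 (volume : Measure Plane)] with x hx
  rw [schwartzToL2, hx, RCLike.inner_apply, conjSchwartz_apply, smul_eq_mul, mul_comm]

/-- Integration by parts against a Schwartz function. -/
theorem HasWeakPartial.inner_lineDeriv {j : Fin 2} {u g : L2} (h : HasWeakPartial j u g)
    (φ : 𝓢(Plane, ℂ)) :
    inner ℂ (schwartzToL2 (∂_{axis j} φ)) u = - inner ℂ (schwartzToL2 φ) g := by
  rw [inner_schwartzToL2, inner_schwartzToL2, ← h, TemperedDistribution.lineDerivOp_apply_apply,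
    map_neg, neg_neg, lineDeriv_conjSchwartz]

theorem weakPartial_schwartz (j : Fin 2) (φ : 𝓢(Plane, ℂ)) :
    weakPartial j (schwartzToH1 φ) = schwartzToL2 (∂_{axis j} φ) :=
  (hasWeakPartial_weakPartial j _).unique (hasWeakPartial_schwartz j φ)

/-- `1 - Δ` is onto on the Schwartz space. -/
theorem exists_sub_laplacian_eq (ψ : 𝓢(Plane, ℂ)) :
    ∃ φ : 𝓢(Plane, ℂ), φ - ∑ j, ∂_{axis j} (∂_{axis j} φ) = ψ := by
  -- The symbol of `(1 - Δ)⁻¹`, a smooth multiplier of temperate growth.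
  set g : Plane → ℂ := fun ξ => ((1 + ‖(2 * Real.pi) • ξ‖ ^ 2 : ℝ) ^ (-1 : ℝ) : ℝ) with hg
  have hgt : g.HasTemperateGrowth := by
    have h1 := Function.hasTemperateGrowth_one_add_norm_sq_rpow Plane (-1)
    have h2 : Function.HasTemperateGrowth fun ξ : Plane => (2 * Real.pi) • ξ :=
      ((2 * Real.pi) • ContinuousLinearMap.id ℝ Plane).hasTemperateGrowth
    exact Function.Complex.hasTemperateGrowth_ofReal.comp (h1.comp h2)
  set φ : 𝓢(Plane, ℂ) := 𝓕⁻ (SchwartzMap.smulLeftCLM ℂ g (𝓕 ψ)) with hφ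
  refine ⟨φ, ?_⟩
  have hφ' : 𝓕 φ = SchwartzMap.smulLeftCLM ℂ g (𝓕 ψ) := by
    rw [hφ, FourierTransform.fourier_fourierInv_eq]
  have hinj : Function.Injective (𝓕 : 𝓢(Plane, ℂ) → 𝓢(Plane, ℂ)) :=
    Function.LeftInverse.injective (g := 𝓕⁻) fun χ => FourierTransform.fourierInv_fourier_eq χ
  apply hinj
  have hd : ∀ (j : Fin 2) (χ : 𝓢(Plane, ℂ)) (ξ : Plane),
      𝓕 (∂_{axis j} χ) ξ = (2 * Real.pi * Complex.I * ξ j) * 𝓕 χ ξ := by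
    intro j χ ξ
    have ht : (fun x : Plane => inner ℝ x (axis j)).HasTemperateGrowth := by fun_prop
    rw [SchwartzMap.fourier_lineDerivOp_eq, _root_.smul_apply,
      SchwartzMap.smulLeftCLM_apply_apply ht]
    simp only [EuclideanSpace.inner_single_right, one_mul, conj_trivial, smul_eq_mul,
      Complex.real_smul]
    ring
  have hsub : 𝓕 (φ - ∑ j, ∂_{axis j} (∂_{axis j} φ))
      = 𝓕 φ - ∑ j, 𝓕 (∂_{axis j} (∂_{axis j} φ)) := by
    change FourierTransform.fourierCLM ℂ 𝓢(Plane, ℂ) _ = _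
    rw [map_sub, map_sum]; rfl
  rw [hsub]
  ext ξ
  rw [_root_.sub_apply, _root_.sum_apply]
  simp only [hd]
  rw [hφ', SchwartzMap.smulLeftCLM_apply_apply hgt, smul_eq_mul, hg]
  have hp : (1 + ‖(2 * Real.pi) • ξ‖ ^ 2 : ℝ) = 1 + (2 * Real.pi) ^ 2 * (ξ 0 ^ 2 + ξ 1 ^ 2) := by
    rw [norm_smul, mul_pow, EuclideanSpace.norm_sq_eq, Fin.sum_univ_two,
      Real.norm_of_nonneg (by positivity)]
    simp
  simp only [Real.rpow_neg_one, hp, Fin.sum_univ_two]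
  have hne : ((1 + (2 * Real.pi) ^ 2 * (ξ 0 ^ 2 + ξ 1 ^ 2) : ℝ) : ℂ) ≠ 0 := by
    rw [Complex.ofReal_ne_zero]; positivity
  rw [Complex.ofReal_inv]
  refine Eq.trans ?_ (mul_inv_cancel_left₀ hne (𝓕 ψ ξ))
  generalize ((1 + (2 * Real.pi) ^ 2 * (ξ 0 ^ 2 + ξ 1 ^ 2) : ℝ) : ℂ)⁻¹ = w
  push_cast
  linear_combination (-(2 * Real.pi) ^ 2 * (ξ 0 ^ 2 + ξ 1 ^ 2) * w * 𝓕 ψ ξ : ℂ) * Complex.I_sq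

/-- The weak derivative is a closed operator. -/
theorem HasWeakPartial.of_tendsto {j : Fin 2} {u g : ℕ → L2} {x y : L2}
    (h : ∀ n, HasWeakPartial j (u n) (g n)) (hu : Tendsto u atTop (𝓝 x))
    (hg : Tendsto g atTop (𝓝 y)) : HasWeakPartial j x y := by
  have hc : ∀ (φ : 𝓢(Plane, ℂ)) (v : ℕ → L2) (z : L2), Tendsto v atTop (𝓝 z) →
      Tendsto (fun n => (v n : 𝓢'(Plane, ℂ)) φ) atTop (𝓝 ((z : 𝓢'(Plane, ℂ)) φ)) := by
    intro φ v z hv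
    have h1 : ∀ w : L2, (w : 𝓢'(Plane, ℂ)) φ = inner ℂ (schwartzToL2 (conjSchwartz φ)) w := by
      intro w
      rw [inner_schwartzToL2]
      congr 1
      ext x
      simp [conjSchwartz_apply]
    simp only [h1]
    exact (tendsto_const_nhds).inner hv
  unfold HasWeakPartial at h ⊢
  ext φ
  refine tendsto_nhds_unique (hc (-∂_{axis j} φ) u x hu) ((hc φ g y hg).congr fun n => ?_)
  rw [← h n]; rfl

/-- Closedness of the form, from boundedness of the trace and coercivity. -/
theorem deltaForm_isClosed {α : ℝ} {m : Measure Plane} {I : H1 →ₗ[ℂ] Lp ℂ 2 m} {K δ C : ℝ}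
    (hK : ∀ u, ‖I u‖ ^ 2 ≤ K * h1NormSq u) (hδ : 0 < δ)
    (hco : ∀ u : H1, δ * ∑ j, ‖weakPartial j u‖ ^ 2 ≤ (deltaForm α m I).quad u + C * ‖(u : L2)‖ ^ 2) :
    (deltaForm α m I).IsClosed := by
  intro u x hx hq
  change ℕ → H1 at u
  have hx0 : Tendsto (fun p : ℕ × ℕ => ‖((u p.1 - u p.2 : H1) : L2)‖ ^ 2) atTop (𝓝 0) := by
    have := (cauchySeq_iff_tendsto_dist_atTop_0.mp hx.cauchySeq).pow 2
    simpa [dist_eq_norm] using this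
  -- Coercivity turns convergence of `q[uₙ - uₘ]` into convergence of the gradients.
  have hg0 : Tendsto (fun p : ℕ × ℕ => ∑ j, ‖weakPartial j (u p.1 - u p.2)‖ ^ 2) atTop (𝓝 0) := by
    have h1 := (hq.add (hx0.const_mul C)).const_mul δ⁻¹
    simp only [mul_zero, add_zero] at h1
    refine squeeze_zero (fun p => Finset.sum_nonneg fun j _ => sq_nonneg _) (fun p => ?_) h1
    rw [← div_eq_inv_mul, le_div_iff₀ hδ, mul_comm]
    exact hco _
  have hcau : ∀ j, CauchySeq fun n => weakPartial j (u n) := by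
    intro j
    rw [cauchySeq_iff_tendsto_dist_atTop_0]
    have h1 : Tendsto (fun p : ℕ × ℕ => ‖weakPartial j (u p.1 - u p.2)‖ ^ 2) atTop (𝓝 0) :=
      squeeze_zero (fun _ => sq_nonneg _) (fun p => Finset.single_le_sum
        (f := fun j => ‖weakPartial j (u p.1 - u p.2)‖ ^ 2) (fun _ _ => sq_nonneg _)
        (Finset.mem_univ j)) hg0
    have h2 := h1.sqrt
    simpa [Real.sqrt_sq, dist_eq_norm] using h2
  choose g hg using fun j => cauchySeq_tendsto_of_complete (hcau j)
  have hw : ∀ j, HasWeakPartial j x (g j) := fun j =>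
    HasWeakPartial.of_tendsto (fun n => hasWeakPartial_weakPartial j (u n)) hx (hg j)
  let v : H1 := ⟨x, fun j => ⟨g j, hw j⟩⟩
  have hv : ∀ j, weakPartial j v = g j := fun j =>
    (hasWeakPartial_weakPartial j v).unique (hw j)
  refine ⟨v, rfl, ?_⟩
  have h1 : ∀ j, Tendsto (fun n => ‖weakPartial j (u n - v)‖ ^ 2) atTop (𝓝 0) := by
    intro j
    have := (tendsto_iff_norm_sub_tendsto_zero.mp (hg j)).pow 2
    simpa [hv] using this
  have h2 : Tendsto (fun n => ∑ j, ‖weakPartial j (u n - v)‖ ^ 2) atTop (𝓝 0) := by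
    simpa using tendsto_finsetSum Finset.univ fun j _ => h1 j
  have h3 : Tendsto (fun n => ‖((u n - v : H1) : L2)‖ ^ 2) atTop (𝓝 0) := by
    have := (tendsto_iff_norm_sub_tendsto_zero.mp hx).pow 2
    simpa [v] using this
  have h4 : Tendsto (fun n => ‖I (u n - v)‖ ^ 2) atTop (𝓝 0) := by
    have := (h3.add h2).const_mul K
    simp only [add_zero, mul_zero] at this
    exact squeeze_zero (fun _ => sq_nonneg _) (fun n => hK _) this
  have h5 := h2.sub (h4.const_mul α)
  simp only [mul_zero, sub_zero] at h5
  exact h5.congr fun n => (deltaForm_quad α m I _).symm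

/-- The Dirichlet form. -/
abbrev dirichletForm : SymmForm L2 := deltaForm 0 0 0

theorem dirichletForm_nonneg (u : dirichletForm.domain) :
    0 * ‖(u : L2)‖ ^ 2 ≤ dirichletForm.quad u := by
  have h := deltaForm_quad 0 0 0 u
  rw [h, zero_mul, zero_mul, sub_zero]
  exact Finset.sum_nonneg fun _ _ => sq_nonneg _

/-- `H¹(ℝ²)` with its Hilbert space structure. -/
abbrev H1Hilbert : Type := EnergySpace dirichletForm 0 dirichletForm_nonneg

/-- The identity, from the form domain to the Hilbert space. -/
abbrev toHilbert : H1 →ₗ[ℂ] H1Hilbert := EnergySpace.mk dirichletForm 0 dirichletForm_nonneg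

/-- The identity, from the Hilbert space to the form domain. -/
abbrev ofHilbert : H1Hilbert →ₗ[ℂ] H1 := EnergySpace.val dirichletForm 0 dirichletForm_nonneg

instance : CompleteSpace H1Hilbert := by
  refine EnergySpace.completeSpace _ _ _ (deltaForm_isClosed (K := 0) (δ := 1) (C := 0) ?_
    one_pos ?_)
  · intro u; simp
  · intro u; rw [deltaForm_quad]; simp

theorem norm_sq_toHilbert (u : H1) : ‖toHilbert u‖ ^ 2 = h1NormSq u := by
  rw [EnergySpace.norm_sq]
  change dirichletForm.quad u + (1 - 0) * ‖(u : L2)‖ ^ 2 = _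
  rw [deltaForm_quad, h1NormSq]
  ring

/-- The embedding of the Schwartz space in `H¹`. -/
def schwartzToHilbert : 𝓢(Plane, ℂ) →ₗ[ℂ] H1Hilbert where
  toFun φ := toHilbert (schwartzToH1 φ)
  map_add' φ ψ := by
    rw [← map_add]
    exact congrArg _ (Subtype.ext (map_add (SchwartzMap.toLpCLM ℂ ℂ 2 volume) φ ψ))
  map_smul' a φ := by
    rw [RingHom.id_apply, ← map_smul]
    exact congrArg _ (Subtype.ext (map_smul (SchwartzMap.toLpCLM ℂ ℂ 2 volume) a φ))

theorem denseRange_schwartzToL2 : DenseRange schwartzToL2 :=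
  SchwartzMap.denseRange_toLpCLM (F := ℂ) (E := Plane) (p := 2) ENNReal.ofNat_ne_top

/-- Schwartz functions are dense in `H¹`. -/
theorem denseRange_schwartzToHilbert : DenseRange schwartzToHilbert := by
  have h : (LinearMap.range schwartzToHilbert)ᗮ = ⊥ := by
    rw [Submodule.eq_bot_iff]
    intro w hw
    set u : H1 := ofHilbert w with hu
    have h1 : ∀ φ : 𝓢(Plane, ℂ), inner ℂ (schwartzToL2 φ) (u : L2) = 0 := by
      intro ψ
      -- Orthogonality to `φ` in `H¹` reads, after integration by parts, `⟨(1 - Δ) φ, u⟩ = 0`; as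
      -- `(1 - Δ) φ` is an arbitrary Schwartz function, `u = 0` in `L²`.
      obtain ⟨φ, hφ⟩ := exists_sub_laplacian_eq ψ
      have h2 : inner ℂ (schwartzToHilbert φ) w = 0 := hw _ ⟨φ, rfl⟩
      rw [EnergySpace.inner_def, EnergySpace.energyInner] at h2
      have h3 : (dirichletForm.form (schwartzToH1 φ) u)
          = ∑ j, inner ℂ (weakPartial j (schwartzToH1 φ)) (weakPartial j u) := by
        change ∑ j, inner ℂ (weakPartial j (schwartzToH1 φ)) (weakPartial j u)
          - ((0 : ℝ) : ℂ) * _ = _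
        simp
      have h4 : inner ℂ (schwartzToL2 ψ) (u : L2) = dirichletForm.form (schwartzToH1 φ) u +
          ((1 - 0 : ℝ) : ℂ) * inner ℂ (schwartzToL2 φ) (u : L2) := by
        rw [h3, ← hφ]
        have h5 : schwartzToL2 (φ - ∑ j, ∂_{axis j} (∂_{axis j} φ))
            = schwartzToL2 φ - ∑ j, schwartzToL2 (∂_{axis j} (∂_{axis j} φ)) := by
          change SchwartzMap.toLpCLM ℂ ℂ 2 volume _ = _
          rw [map_sub, map_sum]; rfl
        rw [h5, inner_sub_left, sum_inner]
        simp only [(hasWeakPartial_weakPartial _ u).inner_lineDeriv, weakPartial_schwartz]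
        simp
        ring
      rw [h4]
      exact h2
    have h2 : (u : L2) = 0 := by
      exact denseRange_schwartzToL2.eq_zero_of_inner_right ℂ h1
    have h3 : u = 0 := Subtype.ext h2
    exact h3
  have h2 := Submodule.topologicalClosure_eq_top_iff.mpr h
  exact Submodule.dense_iff_topologicalClosure_eq_top.mpr h2

theorem dense_H1 : Dense (H1 : Set L2) :=
  denseRange_schwartzToL2.mono (by rintro _ ⟨φ, rfl⟩; exact (schwartzToH1 φ).2)

/-- Required for a non-empty spectrum, which fails on the zero space. -/
instance : Nontrivial L2 := by
  refine ⟨⟨indicatorConstLp 2 (measurableSet_ball (x := (0 : Plane)) (ε := 1))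
    measure_ball_lt_top.ne (1 : ℂ), 0, fun h => ?_⟩⟩
  have h1 := congrArg norm h
  rw [norm_indicatorConstLp (by simp) (by simp), norm_zero] at h1
  have h2 : 0 < (volume : Measure Plane).real (Metric.ball 0 1) :=
    ENNReal.toReal_pos (Metric.measure_ball_pos _ _ one_pos).ne' measure_ball_lt_top.ne
  have : 0 < (volume : Measure Plane).real (Metric.ball 0 1) ^ (1 / (2 : ℝ≥0∞).toReal) :=
    Real.rpow_pos_of_pos h2 _
  simp at h1 this
  linarith

/-! ### Geometry of the curves: the Gaussian Schur bound -/

/-- A naturally parametrised curve is `1`-Lipschitz. -/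
theorem IsNaturalParamOn.lipschitzOnWith {γ : ℝ → Plane} {I : Set ℝ} (h : IsNaturalParamOn γ I)
    (hI : I.OrdConnected) : LipschitzOnWith 1 γ I := by
  obtain ⟨hc, B, hB, hd⟩ := h
  have key : ∀ a ∈ I, ∀ b ∈ I, a ≤ b → ‖γ b - γ a‖ ≤ b - a := by
    intro a ha b hb hab
    have hsub : Icc a b ⊆ I := hI.out ha hb
    -- Finitely many break points form a closed set, so each other point has a neighbourhood free of
    -- them.
    have hder : ∀ s ∈ Ioo a b \ (B ∩ Icc a b), ‖deriv γ s‖ = 1 := by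
      intro s hs
      have ho : IsOpen (Ioo a b \ (B ∩ Icc a b)) := isOpen_Ioo.sdiff (hB a b).isClosed
      obtain ⟨ε, hε, hball⟩ := Metric.isOpen_iff.mp ho s hs
      rw [Real.ball_eq_Ioo] at hball
      refine (hd (s - ε / 2) (s + ε / 2) (by linarith) (fun x hx => hsub ?_) ?_).2 s
        ⟨by linarith, by linarith⟩
      · exact Ioo_subset_Icc_self (hball ⟨by linarith [hx.1], by linarith [hx.2]⟩).1
      · rw [Set.disjoint_left]
        intro x hx hxB
        have := hball (show x ∈ Ioo (s - ε) (s + ε) from ⟨by linarith [hx.1], by linarith [hx.2]⟩)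
        exact this.2 ⟨hxB, Ioo_subset_Icc_self this.1⟩
    have hae : ∀ᵐ s : ℝ, s ∈ Ioc a b → ‖deriv γ s‖ ≤ 1 := by
      have h1 : ∀ᵐ s : ℝ, s ∉ B ∩ Icc a b := (hB a b).measure_zero volume |> measure_eq_zero_iff_ae_notMem.mp
      have h2 : ∀ᵐ s : ℝ, s ≠ b := by simp [ae_iff]
      filter_upwards [h1, h2] with s h1 h2 hs
      exact (hder s ⟨⟨hs.1, lt_of_le_of_ne hs.2 h2⟩, h1⟩).le
    have hint : IntervalIntegrable (deriv γ) volume a b := by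
      rw [intervalIntegrable_iff_integrableOn_Ioc_of_le hab]
      refine Measure.integrableOn_of_bounded (M := 1) (by simp) (aestronglyMeasurable_deriv γ volume) ?_
      rw [ae_restrict_iff' measurableSet_Ioc]
      exact hae
    have hftc := MeasureTheory.integral_eq_of_hasDerivAt_off_countable_of_le γ (deriv γ) hab
      (hB a b).countable (hc.mono hsub) (fun s hs => by
        refine DifferentiableAt.hasDerivAt ?_
        -- At a point of non-differentiability `deriv` is `0` by convention, which contradicts unit
        -- speed.
        by_contra hn
        have := hder s hs
        rw [deriv_zero_of_not_differentiableAt hn, norm_zero] at this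
        exact zero_ne_one this) hint
    rw [← hftc]
    have := intervalIntegral.norm_integral_le_of_norm_le_const_ae (a := a) (b := b) (C := 1)
      (f := deriv γ) (by rwa [uIoc_of_le hab])
    rwa [one_mul, abs_of_nonneg (sub_nonneg.mpr hab)] at this
  refine LipschitzOnWith.of_dist_le_mul fun s hs t ht => ?_
  rw [NNReal.coe_one, one_mul, dist_eq_norm, Real.dist_eq]
  rcases le_total s t with h | h
  · rw [norm_sub_rev, abs_sub_comm, abs_of_nonneg (sub_nonneg.mpr h)]
    exact key s hs t ht h
  · rw [abs_of_nonneg (sub_nonneg.mpr h)]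
    exact key t ht s hs h

/-- The arc length measure on the image of a `1`-Lipschitz map is at most the image of the
Lebesgue measure. -/
theorem lintegral_curveMeasure_image_le {γ : ℝ → Plane} {I : Set ℝ} (hI : MeasurableSet I)
    (hγ : LipschitzOnWith 1 γ I) {f : Plane → ℝ≥0∞} (hf : Measurable f) :
    ∫⁻ y, f y ∂(curveMeasure (γ '' I)) ≤ ∫⁻ s in I, f (γ s) := by
  have hm : AEMeasurable γ (volume.restrict I) := hγ.continuousOn.aemeasurable hI
  rw [← lintegral_map' hf.aemeasurable hm]
  refine lintegral_mono' ?_ le_rfl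
  refine Measure.le_iff.mpr fun s hs => ?_
  rw [curveMeasure, Measure.restrict_apply hs, Measure.map_apply_of_aemeasurable hm hs,
    Measure.restrict_apply' hI]
  have h1 : s ∩ γ '' I ⊆ γ '' (γ ⁻¹' s ∩ I) := by
    rintro _ ⟨hx, t, ht, rfl⟩
    exact ⟨t, ⟨hx, ht⟩, rfl⟩
  have h2 := (hγ.mono (s := γ ⁻¹' s ∩ I) inter_subset_right).hausdorffMeasure_image_le
    (d := 1) zero_le_one
  rw [hausdorffMeasure_real] at h2
  simpa using (measure_mono h1).trans h2

theorem lintegral_gaussian_line {a c : ℝ} (ha : 0 < a) (hc : 0 < c) :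
    ∫⁻ s : ℝ, ENNReal.ofReal (Real.exp (-a * (c * |s|) ^ 2))
      = ENNReal.ofReal (√(Real.pi / a) / c) := by
  have h1 : ∀ s : ℝ, -a * (c * |s|) ^ 2 = -(a * c ^ 2) * s ^ 2 := fun s => by
    rw [mul_pow, sq_abs]; ring
  simp only [h1]
  rw [← ofReal_integral_eq_lintegral_ofReal (integrable_exp_neg_mul_sq (by positivity))
    (Eventually.of_forall fun _ => (Real.exp_pos _).le), integral_gaussian]
  congr 1
  rw [← div_div, Real.sqrt_div (by positivity), Real.sqrt_sq hc.le]

theorem InfiniteCurve.mul_le_dist (C : InfiniteCurve) (s s' : ℝ) :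
    C.c * |s - s'| ≤ dist (C.γ s) (C.γ s') := by
  rcases eq_or_ne s s' with rfl | h
  · simp
  have hp : 0 < |s - s'| := abs_pos.mpr (sub_ne_zero.mpr h)
  rw [← le_div_iff₀ hp]
  refine csInf_le ⟨0, ?_⟩ ⟨s, s', h, rfl⟩
  rintro _ ⟨t, t', _, rfl⟩
  positivity

/-- Pairs at curve distance zero, such as the two ends of the parameter interval, do not enter the
infimum; the sign of `c` settles them. -/
theorem Loop.mul_le_dist (C : Loop) (hc : 0 < C.c) {s s' : ℝ} (hs : s ∈ Icc 0 C.L)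
    (hs' : s' ∈ Icc 0 C.L) : C.c * C.curveDist s s' ≤ dist (C.γ s) (C.γ s') := by
  rcases le_or_gt (C.curveDist s s') 0 with h | h
  · exact (mul_nonpos_of_nonneg_of_nonpos hc.le h).trans dist_nonneg
  rw [← le_div_iff₀ h]
  refine csInf_le ⟨0, ?_⟩ ⟨s, hs, s', hs', h, rfl⟩
  rintro _ ⟨t, _, t', _, ht, rfl⟩
  positivity

/-- On a loop, the integral of a function of the distance along the loop is at most the integral
over the line. -/
theorem Loop.lintegral_curveDist_le (C : Loop) {s₀ : ℝ} (hs₀ : s₀ ∈ Icc 0 C.L) (f : ℝ → ℝ≥0∞) :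
    ∫⁻ s in Icc 0 C.L, f (C.curveDist s₀ s) ≤ ∫⁻ s, f |s| := by
  have hL := C.L_pos
  obtain ⟨h0, h1⟩ := hs₀
  have hshift : ∀ (e a b : ℝ), ∫⁻ s in Ico a b, f |s + e| = ∫⁻ s in Ico (a + e) (b + e), f |s| := by
    intro e a b
    have h := (measurePreserving_add_right (volume : Measure ℝ) e).setLIntegral_comp_preimage_emb
      (MeasurableEquiv.addRight e).measurableEmbedding (fun s => f |s|) (Ico (a + e) (b + e))
    rw [← h]
    simp
  -- Cut at the point `p` opposite to `s₀` and translate the two arcs by `e` and `e'`, so that the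
  -- curve distance becomes `|·|`. The condition `b + e' ≤ a + e` makes the translated arcs
  -- disjoint.
  have hle : ∀ a p b : ℝ, ∀ e e' : ℝ, a ≤ p → p ≤ b → b + e' ≤ a + e →
      (∀ s ∈ Ico a p, C.curveDist s₀ s = |s + e|) → (∀ s ∈ Ico p b, C.curveDist s₀ s = |s + e'|) →
      ∫⁻ s in Ico a b, f (C.curveDist s₀ s) ≤ ∫⁻ s, f |s| := by
    intro a p b e e' hap hpb hee h1 h2
    rw [← Ico_union_Ico_eq_Ico hap hpb]
    refine (lintegral_union_le _ _ _).trans ?_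
    have e1 : ∫⁻ s in Ico a p, f (C.curveDist s₀ s) = ∫⁻ s in Ico a p, f |s + e| :=
      setLIntegral_congr_fun measurableSet_Ico fun s hs => congrArg f (h1 s hs)
    have e2 : ∫⁻ s in Ico p b, f (C.curveDist s₀ s) = ∫⁻ s in Ico p b, f |s + e'| :=
      setLIntegral_congr_fun measurableSet_Ico fun s hs => congrArg f (h2 s hs)
    rw [e1, e2, hshift, hshift, ← lintegral_union measurableSet_Ico]
    · exact setLIntegral_le_lintegral _ _
    · rw [Set.disjoint_left]
      intro x hx hx'
      linarith [hx.1, hx'.2]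
  rw [setLIntegral_congr (Ico_ae_eq_Icc (μ := volume) (a := (0 : ℝ)) (b := C.L)).symm]
  rcases le_total s₀ (C.L / 2) with h | h
  · refine hle 0 (s₀ + C.L / 2) C.L (-s₀) (-s₀ - C.L) (by linarith) (by linarith) (by linarith)
      (fun s hs => ?_) (fun s hs => ?_)
    · rw [Loop.curveDist, min_eq_left, abs_sub_comm, sub_eq_add_neg]
      have : |s₀ - s| ≤ C.L / 2 := abs_le.mpr ⟨by linarith [hs.2], by linarith [hs.1]⟩
      linarith
    · have e1 : |s₀ - s| = s - s₀ := by
        rw [abs_sub_comm, abs_of_nonneg]; linarith [hs.1]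
      rw [Loop.curveDist, e1, min_eq_right (by linarith [hs.1]), abs_of_nonpos (by linarith [hs.2])]
      ring
  · refine hle 0 (s₀ - C.L / 2) C.L (-s₀ + C.L) (-s₀) (by linarith) (by linarith) (by linarith)
      (fun s hs => ?_) (fun s hs => ?_)
    · have e1 : |s₀ - s| = s₀ - s := by
        rw [abs_of_nonneg]; linarith [hs.2]
      rw [Loop.curveDist, e1, min_eq_right (by linarith [hs.2]), abs_of_nonneg (by linarith [hs.1])]
      ring
    · rw [Loop.curveDist, min_eq_left, abs_sub_comm, sub_eq_add_neg]
      have : |s₀ - s| ≤ C.L / 2 := abs_le.mpr ⟨by linarith [hs.2], by linarith [hs.1]⟩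
      linarith

theorem measurable_gaussian_kernel (a : ℝ) (x : Plane) :
    Measurable fun y : Plane => ENNReal.ofReal (Real.exp (-a * ‖x - y‖ ^ 2)) :=
  (ENNReal.continuous_ofReal.comp (by fun_prop)).measurable

theorem ofReal_exp_neg_le {a r r' : ℝ} (ha : 0 < a) (h : r ^ 2 ≤ r' ^ 2) :
    ENNReal.ofReal (Real.exp (-a * r' ^ 2)) ≤ ENNReal.ofReal (Real.exp (-a * r ^ 2)) :=
  ENNReal.ofReal_le_ofReal (Real.exp_le_exp.mpr (by nlinarith))

/-- The Gaussian bound for a curve. -/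
theorem PlaneCurve.lintegral_gaussian_le (C : PlaneCurve) (hc : 0 < C.c) {a : ℝ} (ha : 0 < a)
    {x : Plane} (hx : x ∈ C.carrier) :
    ∫⁻ y, ENNReal.ofReal (Real.exp (-a * ‖x - y‖ ^ 2)) ∂(curveMeasure C.carrier)
      ≤ ENNReal.ofReal (√(Real.pi / a) / C.c) := by
  rw [← lintegral_gaussian_line ha hc]
  cases C with
  | loop C =>
    obtain ⟨s₀, hs₀, rfl⟩ := hx
    refine (lintegral_curveMeasure_image_le measurableSet_Icc
      (C.natural.lipschitzOnWith ordConnected_Icc) (measurable_gaussian_kernel a _)).trans ?_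
    refine le_trans ?_ (C.lintegral_curveDist_le hs₀
      fun r => ENNReal.ofReal (Real.exp (-a * (C.c * r) ^ 2)))
    refine setLIntegral_mono' measurableSet_Icc fun s hs => ofReal_exp_neg_le ha ?_
    have hd : 0 ≤ C.curveDist s₀ s := le_min (abs_nonneg _) (sub_nonneg.mpr
      (abs_le.mpr ⟨by linarith [hs₀.1, hs.2], by linarith [hs₀.2, hs.1]⟩))
    have := C.mul_le_dist hc hs₀ hs
    rw [dist_eq_norm] at this
    exact pow_le_pow_left₀ (mul_nonneg (le_of_lt hc) hd) this 2
  | infinite C =>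
    obtain ⟨s₀, rfl⟩ := hx
    rw [PlaneCurve.carrier, ← image_univ]
    refine (lintegral_curveMeasure_image_le MeasurableSet.univ
      (C.natural.lipschitzOnWith ordConnected_univ) (measurable_gaussian_kernel a _)).trans ?_
    rw [setLIntegral_univ, ← lintegral_sub_right_eq_self
      (fun s => ENNReal.ofReal (Real.exp (-a * ((infinite C).c * |s|) ^ 2))) s₀]
    refine lintegral_mono fun s => ofReal_exp_neg_le ha ?_
    have := C.mul_le_dist s s₀
    rw [dist_comm, dist_eq_norm] at this
    exact pow_le_pow_left₀ (mul_nonneg (le_of_lt hc) (abs_nonneg _)) this 2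

/-- Measurability of `S` places almost every `x` on `S`, hence on the full curve, whose measure
dominates that of `S`. -/
theorem PlaneCurve.gaussianSchur (C : PlaneCurve) (hc : 0 < C.c) {S : Set Plane}
    (hS : MeasurableSet S) (hsub : S ⊆ C.carrier) : GaussianSchur (curveMeasure S) C.c := by
  intro a ha
  filter_upwards [ae_restrict_mem hS] with x hx
  exact (lintegral_mono' (Measure.restrict_mono hsub le_rfl) le_rfl).trans
    (C.lintegral_gaussian_le hc ha (hsub hx))

/-! ### From the trace inequality to the trace map and the form bounds -/

/-- The trace inequality with constant `S`: for all `β > 0`,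
`∫ |φ|² dm ≤ β⁻¹ ‖∇φ‖² + β S ‖φ‖²` for Schwartz functions. -/
def SchwartzTraceBound (m : Measure Plane) (S : ℝ) : Prop :=
  ∀ β : ℝ, 0 < β → ∀ φ : 𝓢(Plane, ℂ), ∫⁻ x, ‖φ x‖ₑ ^ 2 ∂m ≤ ENNReal.ofReal
    (β⁻¹ * ∑ j, ‖schwartzToL2 (∂_{axis j} φ)‖ ^ 2 + β * S * ‖schwartzToL2 φ‖ ^ 2)

theorem schwartzTraceBound_iUnion {N : ℕ} (piece : Fin N → Set Plane) (c : Fin N → ℝ)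
    (hc : ∀ i, 0 < c i) (h : ∀ i, GaussianSchur (curveMeasure (piece i)) (c i)) :
    SchwartzTraceBound (curveMeasure (⋃ i, piece i)) (N * ∑ i, 1 / (4 * c i ^ 2)) := by
  intro β hβ φ
  set G := ∑ j, ‖schwartzToL2 (∂_{axis j} φ)‖ ^ 2 with hG
  have hG0 : 0 ≤ G := Finset.sum_nonneg fun _ _ => sq_nonneg _
  -- The weights below are divided by `N`.
  rcases Nat.eq_zero_or_pos N with rfl | hN
  · rw [show (⋃ i, piece i) = ∅ from iUnion_of_empty piece]
    simp [curveMeasure]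
  have hN' : (0 : ℝ) < N := by exact_mod_cast hN
  calc ∫⁻ x, ‖φ x‖ₑ ^ 2 ∂(curveMeasure (⋃ i, piece i))
      ≤ ∫⁻ x, ‖φ x‖ₑ ^ 2 ∂(Measure.sum fun i => curveMeasure (piece i)) :=
        lintegral_mono' Measure.restrict_iUnion_le le_rfl
    _ = ∑ i, ∫⁻ x, ‖φ x‖ₑ ^ 2 ∂(curveMeasure (piece i)) := by
        rw [lintegral_sum_measure, tsum_fintype]
    -- With `κᵢ = β N / (2 cᵢ)`, the prefactor `1 / (2 κᵢ cᵢ)` is `1 / (β N)` for every piece, and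
    -- the mass coefficient is `β N / (4 cᵢ²)`.
    _ ≤ ∑ i, ENNReal.ofReal (1 / (2 * (β * N / (2 * c i)) * c i) *
          (G + (β * N / (2 * c i)) ^ 2 * ‖schwartzToL2 φ‖ ^ 2)) := by
        refine Finset.sum_le_sum fun i _ => ?_
        have hi := hc i
        have hκ : 0 < β * N / (2 * c i) := by positivity
        rw [ENNReal.ofReal_mul (by positivity), hG, ← fourierEnergy_eq]
        exact (h i).lintegral_schwartz_le hκ hi φ
    _ = ENNReal.ofReal (∑ i, 1 / (2 * (β * N / (2 * c i)) * c i) *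
          (G + (β * N / (2 * c i)) ^ 2 * ‖schwartzToL2 φ‖ ^ 2)) := by
        rw [ENNReal.ofReal_sum_of_nonneg]
        intro i _
        have hi := hc i
        positivity
    _ = _ := by
        congr 1
        have : ∀ i, 1 / (2 * (β * N / (2 * c i)) * c i) *
            (G + (β * N / (2 * c i)) ^ 2 * ‖schwartzToL2 φ‖ ^ 2)
            = (N : ℝ)⁻¹ * (β⁻¹ * G) + β * N * ‖schwartzToL2 φ‖ ^ 2 * (1 / (4 * c i ^ 2)) := fun i => by
          have := (hc i).ne'
          field_simp
          ring
        simp only [this]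
        rw [Finset.sum_add_distrib, Finset.sum_const, ← Finset.mul_sum, Finset.card_univ,
          Fintype.card_fin, nsmul_eq_mul, mul_inv_cancel_left₀ hN'.ne']
        ring

theorem SchwartzTraceBound.memLp {m : Measure Plane} {S : ℝ} (h : SchwartzTraceBound m S)
    (φ : 𝓢(Plane, ℂ)) : MemLp φ 2 m := by
  refine ⟨φ.continuous.aestronglyMeasurable, ?_⟩
  rw [eLpNorm_lt_top_iff_lintegral_rpow_enorm_lt_top (by simp) (by simp)]
  simp only [ENNReal.toReal_ofNat, ENNReal.rpow_ofNat]
  exact (h 1 one_pos φ).trans_lt ENNReal.ofReal_lt_top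

/-- The restriction of Schwartz functions to `L²(m)`. -/
def SchwartzTraceBound.restrict {m : Measure Plane} {S : ℝ} (h : SchwartzTraceBound m S) :
    𝓢(Plane, ℂ) →ₗ[ℂ] Lp ℂ 2 m where
  toFun φ := (h.memLp φ).toLp φ
  map_add' φ ψ := MemLp.toLp_add (h.memLp φ) (h.memLp ψ)
  map_smul' a φ := MemLp.toLp_const_smul a (h.memLp φ)

theorem SchwartzTraceBound.norm_restrict_sq_le {m : Measure Plane} {S : ℝ}
    (h : SchwartzTraceBound m S) (hS : 0 ≤ S) {β : ℝ} (hβ : 0 < β) (φ : 𝓢(Plane, ℂ)) :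
    ‖h.restrict φ‖ ^ 2 ≤ β⁻¹ * ∑ j, ‖weakPartial j (schwartzToH1 φ)‖ ^ 2
      + β * S * ‖(schwartzToH1 φ : L2)‖ ^ 2 := by
  have h1 := h β hβ φ
  have h2 : ∫⁻ x, ‖φ x‖ₑ ^ 2 ∂m = ENNReal.ofReal (‖h.restrict φ‖ ^ 2) := by
    rw [ENNReal.ofReal_pow (norm_nonneg _), ofReal_norm, Lp.enorm_def,
      
      show eLpNorm (h.restrict φ) 2 m = eLpNorm φ 2 m from
        eLpNorm_congr_ae (MemLp.coeFn_toLp (h.memLp φ)),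
      eLpNorm_eq_lintegral_rpow_enorm_toReal (by simp) (by simp)]
    simp only [ENNReal.toReal_ofNat, ENNReal.rpow_ofNat]
    rw [← ENNReal.rpow_natCast, ← ENNReal.rpow_mul]
    norm_num
  rw [h2] at h1
  simp only [weakPartial_schwartz]
  exact (ENNReal.ofReal_le_ofReal_iff (by positivity)).mp h1

/-- Expresses the Dirichlet energy by quantities that are visibly continuous on `H1Hilbert`, for the
density argument. -/
theorem sum_norm_weakPartial_sq (u : H1) :
    ∑ j, ‖weakPartial j u‖ ^ 2 = ‖toHilbert u‖ ^ 2 - ‖(u : L2)‖ ^ 2 := by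
  rw [norm_sq_toHilbert, h1NormSq]; ring

/-- The constant `K` in `IsTrace` carries no sign, whence `max K 0`. -/
theorem exists_norm_le_of_sq_le {m : Measure Plane} {I : H1 →ₗ[ℂ] Lp ℂ 2 m} {K : ℝ}
    (hK : ∀ u, ‖I u‖ ^ 2 ≤ K * h1NormSq u) (w : H1Hilbert) :
    ‖I (ofHilbert w)‖ ≤ √(max K 0) * ‖w‖ := by
  have h1 : h1NormSq (ofHilbert w) = ‖w‖ ^ 2 := (norm_sq_toHilbert (ofHilbert w)).symm
  rw [← Real.sqrt_sq (norm_nonneg w), ← Real.sqrt_mul (le_max_right _ _)]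
  refine Real.le_sqrt_of_sq_le ((hK _).trans ?_)
  rw [h1]
  gcongr
  exact le_max_left _ _

/-- A trace map as a bounded operator. -/
theorem IsTrace.exists_clm {m : Measure Plane} {I : H1 →ₗ[ℂ] Lp ℂ 2 m} (hI : IsTrace m I) :
    ∃ J : H1Hilbert →L[ℂ] Lp ℂ 2 m, ∀ u, J (toHilbert u) = I u := by
  obtain ⟨⟨K, hK⟩, -⟩ := hI
  exact ⟨LinearMap.mkContinuous (I ∘ₗ ofHilbert) _ (exists_norm_le_of_sq_le hK), fun u => rfl⟩

theorem IsTrace.apply_schwartz {m : Measure Plane} {S : ℝ} (h : SchwartzTraceBound m S)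
    {I : H1 →ₗ[ℂ] Lp ℂ 2 m} (hI : IsTrace m I) (φ : 𝓢(Plane, ℂ)) :
    I (schwartzToH1 φ) = h.restrict φ :=
  Lp.ext ((hI.2 φ).trans (MemLp.coeFn_toLp (h.memLp φ)).symm)

/-- Existence and uniqueness of the trace. -/
theorem SchwartzTraceBound.existsUnique_isTrace {m : Measure Plane} {S : ℝ}
    (h : SchwartzTraceBound m S) (hS : 0 ≤ S) : ∃! I : H1 →ₗ[ℂ] Lp ℂ 2 m, IsTrace m I := by
  have hb : ∀ φ, ‖h.restrict φ‖ ≤ √(1 + S) * ‖schwartzToHilbert φ‖ := by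
    intro φ
    have h1 := h.norm_restrict_sq_le hS one_pos φ
    rw [← Real.sqrt_sq (norm_nonneg (schwartzToHilbert φ)), ← Real.sqrt_mul (by positivity)]
    refine Real.le_sqrt_of_sq_le (h1.trans ?_)
    have h2 : ‖schwartzToHilbert φ‖ ^ 2 = h1NormSq (schwartzToH1 φ) := norm_sq_toHilbert _
    rw [h2, h1NormSq]
    have h3 : 0 ≤ ∑ j, ‖weakPartial j (schwartzToH1 φ)‖ ^ 2 :=
      Finset.sum_nonneg fun _ _ => sq_nonneg _
    have h4 := mul_nonneg hS h3
    nlinarith [sq_nonneg ‖(schwartzToH1 φ : L2)‖]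
  set J := h.restrict.extendOfNorm schwartzToHilbert with hJ
  refine ⟨J.toLinearMap ∘ₗ toHilbert, ⟨⟨1 + S, fun u => ?_⟩, fun φ => ?_⟩, fun I hI => ?_⟩
  · have h1 := LinearMap.norm_extendOfNorm_apply_le denseRange_schwartzToHilbert _ hb (toHilbert u)
    have h2 := pow_le_pow_left₀ (norm_nonneg _) h1 2
    rw [mul_pow, Real.sq_sqrt (by positivity), norm_sq_toHilbert] at h2
    exact h2
  · have h1 := LinearMap.extendOfNorm_eq denseRange_schwartzToHilbert ⟨_, hb⟩ φ
    have h2 : (J.toLinearMap ∘ₗ toHilbert) (schwartzToH1 φ) = h.restrict φ := h1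
    rw [h2]
    exact MemLp.coeFn_toLp (h.memLp φ)
  · obtain ⟨J', hJ'⟩ := hI.exists_clm
    -- Two bounded maps that agree on the dense image of the Schwartz space coincide.
    have h1 : J = J' := LinearMap.extendOfNorm_unique denseRange_schwartzToHilbert _ hb J' (by
      ext1 φ
      exact (hJ' _).trans (hI.apply_schwartz h φ))
    ext1 u
    rw [← hJ', h1]; rfl

/-- The trace inequality on `H¹`. -/
theorem IsTrace.norm_sq_le {m : Measure Plane} {S : ℝ} (h : SchwartzTraceBound m S) (hS : 0 ≤ S)
    {I : H1 →ₗ[ℂ] Lp ℂ 2 m} (hI : IsTrace m I) {β : ℝ} (hβ : 0 < β) (u : H1) :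
    ‖I u‖ ^ 2 ≤ β⁻¹ * ∑ j, ‖weakPartial j u‖ ^ 2 + β * S * ‖(u : L2)‖ ^ 2 := by
  obtain ⟨J, hJ⟩ := hI.exists_clm
  let E := EnergySpace.incl dirichletForm 0 dirichletForm_nonneg
  have hcl : IsClosed {w : H1Hilbert | ‖J w‖ ^ 2 ≤ β⁻¹ * (‖w‖ ^ 2 - ‖E w‖ ^ 2) + β * S * ‖E w‖ ^ 2} :=
    isClosed_le (by fun_prop) (by fun_prop)
  have h1 : ∀ w : H1Hilbert, ‖J w‖ ^ 2 ≤ β⁻¹ * (‖w‖ ^ 2 - ‖E w‖ ^ 2) + β * S * ‖E w‖ ^ 2 := by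
    refine fun w => denseRange_schwartzToHilbert.induction_on w hcl fun φ => ?_
    have h2 := h.norm_restrict_sq_le hS hβ φ
    rw [sum_norm_weakPartial_sq, ← hI.apply_schwartz h, ← hJ] at h2
    exact h2
  rw [sum_norm_weakPartial_sq, ← hJ]
  exact h1 (toHilbert u)

/-- Closedness and the lower bound of the form, for a measure with the trace inequality. -/
theorem SchwartzTraceBound.deltaForm_isClosed_and_le {m : Measure Plane} {S : ℝ} (h : SchwartzTraceBound m S)
    (hS : 0 ≤ S) {α : ℝ} (hα : 0 < α) {I : H1 →ₗ[ℂ] Lp ℂ 2 m} (hI : IsTrace m I) :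
    (deltaForm α m I).IsClosed ∧ ∀ u : H1, -(α ^ 2 * S) * ‖(u : L2)‖ ^ 2 ≤ (deltaForm α m I).quad u := by
  obtain ⟨K, hK⟩ := hI.1
  refine ⟨deltaForm_isClosed (δ := 1 / 2) (C := 2 * α ^ 2 * S) hK (by norm_num) fun u => ?_,
    fun u => ?_⟩
  -- With `β = 2α`, the trace term uses half of the Dirichlet energy and leaves `δ = 1/2`.
  · have h1 := mul_le_mul_of_nonneg_left (hI.norm_sq_le h hS (β := 2 * α) (by positivity) u) hα.le
    rw [deltaForm_quad]
    have h2 : α * ((2 * α)⁻¹ * ∑ j, ‖weakPartial j u‖ ^ 2 + 2 * α * S * ‖(u : L2)‖ ^ 2)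
        = 1 / 2 * ∑ j, ‖weakPartial j u‖ ^ 2 + 2 * α ^ 2 * S * ‖(u : L2)‖ ^ 2 := by
      field_simp
    linarith
  -- With `β = α`, the trace term uses exactly the whole Dirichlet energy; the mass term left over
  -- is the lower bound.
  · have h1 := mul_le_mul_of_nonneg_left (hI.norm_sq_le h hS hα u) hα.le
    rw [deltaForm_quad]
    have h2 : α * (α⁻¹ * ∑ j, ‖weakPartial j u‖ ^ 2 + α * S * ‖(u : L2)‖ ^ 2)
        = ∑ j, ‖weakPartial j u‖ ^ 2 + α ^ 2 * S * ‖(u : L2)‖ ^ 2 := by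
      field_simp
    linarith

theorem SymmForm.IsAssociated.le_of_mem_realSpectrum {H : Type*} [NormedAddCommGroup H]
    [InnerProductSpace ℂ H] [CompleteSpace H] {q : SymmForm H}
    {A : H →ₗ.[ℂ] H} (hA : q.IsAssociated A) (hq : q.IsClosed)
    {b : ℝ} (hb : ∀ u : q.domain, b * ‖(u : H)‖ ^ 2 ≤ q.quad u) {x : ℝ} (hx : x ∈ realSpectrum A) :
    b ≤ x := by
  obtain ⟨z, hz, rfl⟩ := hx
  by_contra hlt
  exact hz (hA.mem_resolventSet hq hb (not_le.mp hlt))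

end LeakyWire

end

/-- The leaky wire Hamiltonian: trace, closed form, self-adjoint operator and the lower bound of its
spectrum. -/
theorem theorem3 (α : ℝ) (hα : 0 < α) (N : ℕ)
    (Γ : Set LeakyWire.Plane) (piece : Fin N → Set LeakyWire.Plane)
    (ext : Fin N → LeakyWire.PlaneCurve)
    (hmeas : ∀ i, MeasurableSet (piece i))
    (hΓ : Γ = ⋃ i, piece i)
    (hsub : ∀ i, piece i ⊆ (ext i).carrier)
    (hc : ∀ i, 0 < (ext i).c)
    (hext : ∀ i, (ext i).LoopOrStraight) :
    (∃! I : LeakyWire.H1 →ₗ[ℂ] Lp ℂ 2 (LeakyWire.curveMeasure Γ),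
      LeakyWire.IsTrace (LeakyWire.curveMeasure Γ) I) ∧
    ∀ I : LeakyWire.H1 →ₗ[ℂ] Lp ℂ 2 (LeakyWire.curveMeasure Γ),
      LeakyWire.IsTrace (LeakyWire.curveMeasure Γ) I →
      (LeakyWire.deltaForm α (LeakyWire.curveMeasure Γ) I).IsClosed ∧
      (LeakyWire.deltaForm α (LeakyWire.curveMeasure Γ) I).IsBoundedBelow ∧
      (∃! A : LeakyWire.L2 →ₗ.[ℂ] LeakyWire.L2, IsSelfAdjoint A ∧
        (LeakyWire.deltaForm α (LeakyWire.curveMeasure Γ) I).IsAssociated A) ∧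
      ∀ A : LeakyWire.L2 →ₗ.[ℂ] LeakyWire.L2, IsSelfAdjoint A →
        (LeakyWire.deltaForm α (LeakyWire.curveMeasure Γ) I).IsAssociated A →
        (LeakyWire.realSpectrum A).Nonempty ∧ BddBelow (LeakyWire.realSpectrum A) ∧
        -((N : ℝ) * ∑ i, α ^ 2 / (4 * (ext i).c ^ 2)) ≤ sInf (LeakyWire.realSpectrum A) := by
  subst hΓ
  set S : ℝ := N * ∑ i, 1 / (4 * (ext i).c ^ 2) with hSdef
  have hS : 0 ≤ S := by positivity
  have h : LeakyWire.SchwartzTraceBound (LeakyWire.curveMeasure (⋃ i, piece i)) S :=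
    LeakyWire.schwartzTraceBound_iUnion piece (fun i => (ext i).c) hc fun i =>
      (ext i).gaussianSchur (hc i) (hmeas i) (hsub i)
  refine ⟨h.existsUnique_isTrace hS, fun I hI => ?_⟩
  obtain ⟨hcl, hb⟩ := h.deltaForm_isClosed_and_le hS hα hI
  have hbb : (LeakyWire.deltaForm α (LeakyWire.curveMeasure (⋃ i, piece i)) I).IsBoundedBelow :=
    ⟨_, hb⟩
  refine ⟨hcl, hbb, ?_, fun A hA hAq => ?_⟩
  · obtain ⟨A, hA, hAq⟩ := LeakyWire.SymmForm.exists_isSelfAdjoint_isAssociated _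
      LeakyWire.dense_H1 hcl hbb
    exact ⟨A, ⟨hA, hAq⟩, fun A' hA' => hA'.2.eq hAq⟩
  · have hlow : ∀ x ∈ LeakyWire.realSpectrum A, -(α ^ 2 * S) ≤ x := fun x hx =>
      hAq.le_of_mem_realSpectrum hcl hb hx
    -- A real resolvent point is what `spectrum_nonempty` asks for. Non-emptiness also makes `sInf`
    -- a genuine infimum, as `sInf ∅ = 0` by convention.
    have hres : ((-(α ^ 2 * S) - 1 : ℝ) : ℂ) ∈ LeakyWire.resolventSet A :=
      hAq.mem_resolventSet hcl hb (by rw [Complex.ofReal_re]; linarith)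
    have hne : (LeakyWire.realSpectrum A).Nonempty :=
      (LeakyWire.spectrum_nonempty hA hres).image _
    refine ⟨hne, ⟨_, hlow⟩, ?_⟩
    have hB : (N : ℝ) * ∑ i, α ^ 2 / (4 * (ext i).c ^ 2) = α ^ 2 * S := by
      have hi : ∀ i, α ^ 2 / (4 * (ext i).c ^ 2) = α ^ 2 * (1 / (4 * (ext i).c ^ 2)) := fun i => by
        ring
      simp only [hi]
      rw [← Finset.mul_sum, hSdef, mul_left_comm]
    rw [hB]
    exact le_csInf hne hlow
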